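/- Write $\mathbb{C}^+=\{z\in\mathbb{C}:\operatorname{Im} z>0\}$. Let $\varphi:\mathbb{C}^+\to\mathbb{C}^+$ be analytic and of the form $$\varphi(z)=\frac{\lambda_1 z^{a_1}+\lambda_2 z^{a_2}+\dots+\lambda_m z^{a_m}}{\mu_1 z^{b_1}+\mu_2 z^{b_2}+\dots+\mu_n z^{b_n}},$$ where $m,n\ge 1$, the coefficients $\lambda_i,\mu_j$ are complex with $\lambda_1\neq0$ and $\mu_1\ne 0$, the exponents are non-negative real numbers with $a_1>a_2>\dots>a_m\ge 0$ and $b_1>b_2>\dots>b_n\ge 0$, and $z^s$ denotes the principal branch (zeros of the denominator in $\mathbb{C}^+$ are allowed only as removable singularities of the quotient). Let $1\le p<\infty$. Let $H^p(\mathbb{C}^+)$ be the space of analytic $F:\mathbb{C}^+\to\mathbb{C}$ with $\|F\|_{H^p}=\sup_{y>0}\big(\int_{\mathbb{R}}|F(x+iy)|^p\,dx\big)^{1/p}<\infty$, on which $C_\varphi F=F\circ\varphi$. On $L^p(\mathbb{R})$ let $(C_\varphi f)(x)=\tilde f(\varphi(x))$ for almost every $x\in\mathbb{R}$, where $\varphi(x)$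 is the non-tangential limit of $\varphi$ at $x$, and $\tilde f$ is equal to $f$ on $\mathbb{R}$ and to the Poisson integral of $f$ on $\mathbb{C}^+$. Then: 1. $C_\varphi$ is a bounded operator from $L^p(\mathbb{R})$ to itself if and only if $a_1-b_1\ge1$; 2. $C_\varphi$ is a bounded operator from $H^p(\mathbb{C}^+)$ to itself if and only if $a_1-b_1\ge1$. -/

import Mathlib

open MeasureTheory Filter Topology
open UpperHalfPlane (upperHalfPlaneSet)
open scoped ENNReal NNReal

noncomputable section

namespace HalfPlane

/-- Linear combination `∑ cᵢ z ^ eᵢ` of real powers of `z`. The powers are the principal ones,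
`z ^ e = exp (e * (log |z| + i * arg z))` with `arg z ∈ (-π, π]`. -/
def powerSum {m : ℕ} (c : Fin m → ℂ) (e : Fin m → ℝ) (z : ℂ) : ℂ :=
  ∑ i, c i * z ^ ((e i : ℝ) : ℂ)

/-- `φ` is an analytic self-map of the upper half-plane which is the quotient of
`∑ lamᵢ z ^ aᵢ` and `∑ muⱼ z ^ bⱼ`, with nonnegative real exponents in descending order and
non-zero leading coefficients. Possible zeros of the denominator are removable singularities of the
quotient, and only the values of `φ` on the open upper half-plane matter. -/
structure IsQLP {m n : ℕ} (lam : Fin (m + 1) → ℂ) (a : Fin (m + 1) → ℝ)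
    (mu : Fin (n + 1) → ℂ) (b : Fin (n + 1) → ℝ) (φ : ℂ → ℂ) : Prop where
  a_nonneg : ∀ i, 0 ≤ a i
  b_nonneg : ∀ j, 0 ≤ b j
  a_strictAnti : StrictAnti a
  b_strictAnti : StrictAnti b
  lam_ne_zero : lam 0 ≠ 0
  mu_ne_zero : mu 0 ≠ 0
  differentiableOn : DifferentiableOn ℂ φ upperHalfPlaneSet
  mapsTo : Set.MapsTo φ upperHalfPlaneSet upperHalfPlaneSet
  eq_div : ∀ z ∈ upperHalfPlaneSet, powerSum mu b z ≠ 0 →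
    φ z = powerSum lam a z / powerSum mu b z

/-- The Hardy norm `sup_{y > 0} (∫ |F (x + i y)| ^ p dx) ^ (1 / p)`, with values in `[0, ∞]`. -/
def hardyNorm (F : ℂ → ℂ) (p : ℝ≥0∞) : ℝ≥0∞ :=
  ⨆ (y : ℝ) (_ : 0 < y), eLpNorm (fun x : ℝ => F (x + y * Complex.I)) p volume

/-- `F` belongs to the Hardy space `H^p` of the upper half-plane. -/
def MemHardy (F : ℂ → ℂ) (p : ℝ≥0∞) : Prop :=
  DifferentiableOn ℂ F upperHalfPlaneSet ∧ hardyNorm F p < ∞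

/-- `F ↦ F ∘ φ` is a bounded operator from `H^p` of the upper half-plane to itself. -/
def CompBoundedOnHardy (φ : ℂ → ℂ) (p : ℝ≥0∞) : Prop :=
  ∃ C : ℝ≥0, ∀ F : ℂ → ℂ, MemHardy F p →
    MemHardy (F ∘ φ) p ∧ hardyNorm (F ∘ φ) p ≤ C * hardyNorm F p

/-- Poisson integral `(1 / π) ∫ y / ((x - t)² + y²) f t dt` at `z = x + i y`. -/
def poissonIntegral (f : ℝ → ℂ) (z : ℂ) : ℂ :=
  ∫ t : ℝ, ((1 / Real.pi * (z.im / ((z.re - t) ^ 2 + z.im ^ 2)) : ℝ) : ℂ) * f t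

/-- Extension of `f : ℝ → ℂ` to the closed upper half-plane: its Poisson integral in the open
half-plane and `f` itself on the real line. -/
def extend (f : ℝ → ℂ) (z : ℂ) : ℂ :=
  if 0 < z.im then poissonIntegral f z else f z.re

/-- Non-tangential approach to the real point `x` from the upper half-plane: a function tends to `l`
along this filter iff it does so within each cone `|Re z - x| < α Im z`, `α > 0`. -/
def nontangential (x : ℝ) : Filter ℂ :=
  ⨆ (α : ℝ) (_ : 0 < α), 𝓝[{z : ℂ | |z.re - x| < α * z.im}] (x : ℂ)

/-- Boundary function of `φ` on the real line, given by non-tangential limits. For an analytic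
self-map of the upper half-plane these exist at almost every point; elsewhere the value is junk. -/
def boundaryValue (φ : ℂ → ℂ) (x : ℝ) : ℂ :=
  limUnder (nontangential x) φ

/-- The composition `C_φ f` of `f : ℝ → ℂ` with `φ`, as a function on the real line. -/
def compLine (φ : ℂ → ℂ) (f : ℝ → ℂ) (x : ℝ) : ℂ :=
  extend f (boundaryValue φ x)

/-- `f ↦ C_φ f` is a bounded operator from `L^p(ℝ)` to itself. The norm bound also says that
`C_φ f` only depends on the almost-everywhere class of `f`. -/
def CompBoundedOnLp (φ : ℂ → ℂ) (p : ℝ≥0∞) : Prop :=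
  ∃ C : ℝ≥0, ∀ f : ℝ → ℂ, MemLp f p volume →
    MemLp (compLine φ f) p volume ∧
      eLpNorm (compLine φ f) p volume ≤ C * eLpNorm f p volume

end HalfPlane

end

/-! Both boundedness statements are equivalent to linear growth of `φ` on the imaginary axis: `c * Y
≤ ‖φ (iY)‖` for large `Y`, with some `c > 0`. As leading terms dominate, `‖φ (iY)‖` behaves like a
constant times `Y ^ (a 0 - b 0)`, so growth means `1 ≤ a 0 - b 0` (`IsQLP.exists_growth_iff`).

Growth suffices. For real `t`, `Im (-1 / (φ - t))` is `π` times the Poisson kernel composed with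
`φ`. After small vertical shifts this function is bounded, and the Poisson formula at `in`, as `n →
∞`, bounds its integral over a horizontal line by a constant independent of `t` and of the line
(`lintegral_kernel_comp_le`). Jensen and Tonelli turn this into norm bounds. On `H^p`, `‖F‖ ^ q` is
dominated by Poisson integrals from lower lines (`lintegral_comp_le_of_kernel`). On `L^p`, the
boundary values inside the half-plane are treated in the same way, while the real ones have a
distribution at most a multiple of Lebesgue measure, by covering with balls (`realValueMeasure_le`).

Growth is necessary. With `w = φ (iY)`, the test function `(Im w / (z - conj w)) ^ 2` has modulus
`1/4` at `w`, and its `p`-norm to the power `p` is at most `π * Im w`. Evaluation of the composite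
at `iY` costs at most `2 / (π * Y)`, so boundedness forces `Im w` to be at least a constant times
`Y` (`growth_of_testFunction`). -/

noncomputable section

namespace HalfPlane

/-! ### Poisson kernel and Jensen's inequality. -/

/-- Poisson kernel of the upper half-plane. -/
def kernel (z : ℂ) (t : ℝ) : ℝ := 1 / Real.pi * (z.im / ((z.re - t) ^ 2 + z.im ^ 2))

/-- Harmonic measure on the real line, seen from `z`. -/
def harmonicMeasure (z : ℂ) : Measure ℝ := volume.withDensity fun t => ENNReal.ofReal (kernel z t)

lemma kernel_nonneg {z : ℂ} (hz : 0 ≤ z.im) (t : ℝ) : 0 ≤ kernel z t := by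
  unfold kernel; positivity

lemma measurable_kernel : Measurable fun q : ℂ × ℝ => kernel q.1 q.2 := by
  unfold kernel; fun_prop

lemma measurable_kernel_right (z : ℂ) : Measurable (kernel z) :=
  measurable_kernel.comp (measurable_const.prodMk measurable_id)

lemma kernel_le {z : ℂ} (hz : 0 < z.im) (t : ℝ) : kernel z t ≤ 1 / (Real.pi * z.im) := by
  unfold kernel
  rw [div_mul_div_comm, one_mul, div_le_div_iff₀ (by positivity) (by positivity)]
  have := Real.pi_pos
  nlinarith [mul_nonneg this.le (sq_nonneg (z.re - t))]

/-- This form exhibits the kernel composed with a holomorphic map as the imaginary part of a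
holomorphic function. -/
lemma kernel_eq_im_div {z : ℂ} (t : ℝ) : kernel z t = 1 / Real.pi * (-1 / (z - t)).im := by
  unfold kernel
  congr 1
  rw [Complex.div_im]
  simp [Complex.normSq_apply, sq, neg_div]

lemma kernel_eq_normSq (z : ℂ) (t : ℝ) : kernel z t = z.im / Real.pi * (‖z - t‖ ^ 2)⁻¹ := by
  unfold kernel
  rw [← Complex.normSq_eq_norm_sq, Complex.normSq_apply]
  simp only [Complex.sub_re, Complex.ofReal_re, Complex.sub_im, Complex.ofReal_im, sub_zero]
  ring

/-- Kernels at two heights on a vertical line are comparable. -/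
lemma kernel_le_kernel_add {z : ℂ} (hz : 0 < z.im) {δ : ℝ} (hδ : 0 ≤ δ) (t : ℝ) :
    kernel z t ≤ (z.im + δ) / z.im * kernel (z + δ * Complex.I) t := by
  unfold kernel
  simp only [Complex.add_re, Complex.mul_re, Complex.ofReal_re, Complex.I_re, mul_zero,
    Complex.ofReal_im, Complex.I_im, mul_one, sub_self, add_zero, Complex.add_im, Complex.mul_im]
  rw [mul_left_comm]
  gcongr
  rw [div_mul_div_comm, div_le_div_iff₀ (by positivity) (by positivity)]
  nlinarith [mul_nonneg (sq_nonneg (z.re - t)) (show 0 ≤ (z.im + δ) ^ 2 - z.im ^ 2 by nlinarith)]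

lemma kernel_eq_cauchyPDFReal {z : ℂ} (hz : 0 ≤ z.im) (t : ℝ) :
    kernel z t = ProbabilityTheory.cauchyPDFReal z.re z.im.toNNReal t := by
  rw [ProbabilityTheory.cauchyPDFReal_def, kernel]
  rw [Real.coe_toNNReal _ hz]
  rw [← neg_sub, neg_sq]
  ring

lemma lintegral_kernel {z : ℂ} (hz : 0 < z.im) : ∫⁻ t, ENNReal.ofReal (kernel z t) = 1 := by
  simp_rw [kernel_eq_cauchyPDFReal hz.le]
  exact ProbabilityTheory.lintegral_cauchyPDF_eq_one z.re (γ := z.im.toNNReal)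
    (by simpa using hz)

lemma integrable_kernel {z : ℂ} (hz : 0 < z.im) : Integrable (kernel z) := by
  rw [show kernel z = _ from funext (kernel_eq_cauchyPDFReal hz.le)]
  exact ProbabilityTheory.integrable_cauchyPDFReal _

lemma integral_kernel {z : ℂ} (hz : 0 < z.im) : ∫ t, kernel z t = 1 := by
  simp_rw [kernel_eq_cauchyPDFReal hz.le]
  exact ProbabilityTheory.integral_cauchyPDFReal_eq_one z.re (γ := z.im.toNNReal)
    (by simpa using hz)

lemma isProbabilityMeasure_harmonicMeasure {z : ℂ} (hz : 0 < z.im) :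
    IsProbabilityMeasure (harmonicMeasure z) :=
  ⟨by rw [harmonicMeasure, withDensity_apply _ MeasurableSet.univ, Measure.restrict_univ,
    lintegral_kernel hz]⟩

lemma poissonIntegral_eq (f : ℝ → ℂ) (z : ℂ) :
    poissonIntegral f z = ∫ t, (kernel z t : ℂ) * f t := rfl

lemma poissonIntegral_eq_integral {z : ℂ} (hz : 0 < z.im) (f : ℝ → ℂ) :
    poissonIntegral f z = ∫ t, f t ∂harmonicMeasure z := by
  rw [harmonicMeasure, integral_withDensity_eq_integral_toReal_smul
    (measurable_kernel_right z).ennreal_ofReal (by simp)]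
  refine integral_congr_ae (Eventually.of_forall fun t => ?_)
  simp only
  rw [ENNReal.toReal_ofReal (kernel_nonneg hz.le t), Complex.real_smul]
  rfl

lemma poissonIntegral_congr {f g : ℝ → ℂ} (h : f =ᵐ[volume] g) (z : ℂ) :
    poissonIntegral f z = poissonIntegral g z :=
  integral_congr_ae (h.mono fun t ht => by simp only [ht])

lemma rpow_enorm_integral_le {μ : Measure ℝ} [IsProbabilityMeasure μ] {f : ℝ → ℂ}
    (hf : AEStronglyMeasurable f μ) {q : ℝ} (hq : 1 ≤ q) :
    ‖∫ t, f t ∂μ‖ₑ ^ q ≤ ∫⁻ t, ‖f t‖ₑ ^ q ∂μ := by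
  have h0 : 0 < q := by linarith
  have h1 := (enorm_integral_le_lintegral_enorm (μ := μ) f)
  rw [← eLpNorm_one_eq_lintegral_enorm] at h1
  have h2 := h1.trans (eLpNorm_le_eLpNorm_of_exponent_le
    (show (1 : ℝ≥0∞) ≤ ENNReal.ofReal q by simpa using hq) hf)
  rw [eLpNorm_eq_lintegral_rpow_enorm_toReal (by simpa using h0) (by simp),
    ENNReal.toReal_ofReal h0.le] at h2
  calc _ ≤ _ := ENNReal.rpow_le_rpow h2 h0.le
    _ = _ := by rw [← ENNReal.rpow_mul, one_div, inv_mul_cancel₀ h0.ne', ENNReal.rpow_one]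

/-- Jensen's inequality for the Poisson integral. -/
lemma rpow_enorm_poissonIntegral_le {z : ℂ} (hz : 0 < z.im) {f : ℝ → ℂ}
    (hf : AEStronglyMeasurable f volume) {q : ℝ} (hq : 1 ≤ q) :
    ‖poissonIntegral f z‖ₑ ^ q ≤ ∫⁻ t, ENNReal.ofReal (kernel z t) * ‖f t‖ₑ ^ q := by
  have := isProbabilityMeasure_harmonicMeasure hz
  rw [poissonIntegral_eq_integral hz]
  refine (rpow_enorm_integral_le (μ := harmonicMeasure z)
    (hf.mono_ac (withDensity_absolutelyContinuous _ _)) hq).trans ?_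
  rw [harmonicMeasure, lintegral_withDensity_eq_lintegral_mul₀
    (measurable_kernel_right z).ennreal_ofReal.aemeasurable (hf.enorm.pow_const q)]
  rfl

/-- Fatou's lemma, in the form used for each later passage to the limit. -/
lemma lintegral_le_of_le_liminf {f : ℝ → ℝ≥0∞} {g : ℕ → ℝ → ℝ≥0∞} {B : ℝ≥0∞}
    (hg : ∀ n, AEMeasurable (g n) volume) (hB : ∀ᶠ n in atTop, ∫⁻ x, g n x ≤ B)
    (h : ∀ᵐ x, f x ≤ liminf (fun n => g n x) atTop) : ∫⁻ x, f x ≤ B :=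
  calc _ ≤ _ := lintegral_mono_ae h
    _ ≤ liminf (fun n => ∫⁻ x, g n x) atTop := lintegral_liminf_le' hg
    _ ≤ B := liminf_le_of_le (by isBoundedDefault) fun b hb => by
        obtain ⟨n, h1, h2⟩ := (hb.and hB).exists
        exact h1.trans h2

/-! ### Poisson formula for bounded holomorphic functions. -/

/-- Cauchy's theorem for the upper half-plane, for functions that are `O(|z|⁻²)` at infinity. -/
lemma integral_ofReal_eq_zero_of_decay {h : ℂ → ℂ} (hc : ContinuousOn h {z | 0 ≤ z.im})
    (hd : DifferentiableOn ℂ h {z | 0 < z.im}) {C R₀ : ℝ}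
    (hb : ∀ z : ℂ, 0 ≤ z.im → R₀ ≤ ‖z‖ → ‖h z‖ ≤ C / ‖z‖ ^ 2)
    (hi : Integrable fun t : ℝ => h t) : ∫ t : ℝ, h t = 0 := by
  -- On the rectangle `[-R, R] × [0, R]` the three sides off the real line have total length `4R`,
  -- and the integrand there is at most `|C| / R ^ 2`.
  have key : ∀ R : ℝ, 0 < R → R₀ ≤ R → ‖∫ t in (-R)..R, h t‖ ≤ 4 * |C| * R⁻¹ := by
    intro R hR hR₀
    have H := Complex.integral_boundary_rect_eq_zero_of_continuousOn_of_differentiableOn h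
      (-R : ℝ) (R + R * Complex.I) (hc.mono ?_) (hd.mono ?_)
    · simp only [Complex.ofReal_re, Complex.ofReal_im, Complex.add_re, Complex.mul_re,
        Complex.I_re, Complex.I_im, Complex.add_im, Complex.mul_im, mul_zero, mul_one, sub_zero,
        add_zero, zero_add, Complex.ofReal_zero, zero_mul] at H
      have bd : ∀ z : ℂ, 0 ≤ z.im → R ≤ ‖z‖ → ‖h z‖ ≤ |C| / R ^ 2 := fun z hz hzR =>
        (hb z hz (hR₀.trans hzR)).trans (by gcongr; exact le_abs_self C)
      have h1 : ‖∫ x in (-R)..R, h (x + R * Complex.I)‖ ≤ |C| / R ^ 2 * |R - -R| := by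
        refine intervalIntegral.norm_integral_le_of_norm_le_const fun x _ => bd _ ?_ ?_
        · simp [hR.le]
        · refine le_trans ?_ (Complex.abs_im_le_norm _)
          simp [le_abs_self]
      have h2 : ‖∫ y in (0 : ℝ)..R, h (R + y * Complex.I)‖ ≤ |C| / R ^ 2 * |R - 0| := by
        refine intervalIntegral.norm_integral_le_of_norm_le_const fun x hx => bd _ ?_ ?_
        · rw [Set.uIoc_of_le hR.le] at hx
          simp [hx.1.le]
        · refine le_trans ?_ (Complex.abs_re_le_norm _)
          simp [le_abs_self]
      have h3 : ‖∫ y in (0 : ℝ)..R, h ((-R : ℝ) + y * Complex.I)‖ ≤ |C| / R ^ 2 * |R - 0| := by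
        refine intervalIntegral.norm_integral_le_of_norm_le_const fun x hx => bd _ ?_ ?_
        · rw [Set.uIoc_of_le hR.le] at hx
          simp [hx.1.le]
        · refine le_trans ?_ (Complex.abs_re_le_norm _)
          simp [le_abs_self]
      set A := ∫ x in (-R)..R, h (x + R * Complex.I)
      set B := ∫ y in (0 : ℝ)..R, h (R + y * Complex.I)
      set D := ∫ y in (0 : ℝ)..R, h ((-R : ℝ) + y * Complex.I)
      have e : ∫ t in (-R)..R, h t = A - Complex.I • B + Complex.I • D := by
        linear_combination H
      rw [e]
      refine (norm_add_le _ _).trans ((add_le_add_left (norm_sub_le _ _) _).trans ?_)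
      rw [norm_smul, norm_smul, Complex.norm_I, one_mul, one_mul]
      rw [show R - -R = 2 * R by ring, abs_of_pos (show 0 < 2 * R by positivity)] at h1
      rw [sub_zero, abs_of_pos hR] at h2 h3
      calc _ ≤ _ := add_le_add (add_le_add h1 h2) h3
        _ = _ := by field_simp; ring
    · intro z hz
      rw [Complex.mem_reProdIm] at hz
      have := hz.2
      simp only [Complex.ofReal_im, Complex.add_im, Complex.mul_im, Complex.ofReal_re,
        Complex.I_im, Complex.I_re, mul_one, mul_zero, add_zero, zero_add,
        Set.uIcc_of_le hR.le] at this
      exact this.1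
    · intro z hz
      rw [Complex.mem_reProdIm] at hz
      have := hz.2
      simp only [Complex.ofReal_im, Complex.add_im, Complex.mul_im, Complex.ofReal_re,
        Complex.I_im, Complex.I_re, mul_one, mul_zero, add_zero, zero_add,
        min_eq_left hR.le] at this
      exact this.1
  have t1 := intervalIntegral_tendsto_integral hi tendsto_neg_atTop_atBot tendsto_id
  have t2 : Tendsto (fun R : ℝ => 4 * |C| * R⁻¹) atTop (𝓝 0) := by
    simpa using tendsto_inv_atTop_zero.const_mul (4 * |C|)
  refine tendsto_nhds_unique t1 (squeeze_zero_norm' ?_ t2)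
  filter_upwards [eventually_gt_atTop 0, eventually_ge_atTop R₀] with R h1 h2 using key R h1 h2

/-- The Poisson formula for bounded holomorphic functions. -/
lemma poissonIntegral_ofReal_eq {g : ℂ → ℂ} (hc : ContinuousOn g {z | 0 ≤ z.im})
    (hd : DifferentiableOn ℂ g {z | 0 < z.im}) {M : ℝ} (hM : ∀ z : ℂ, 0 ≤ z.im → ‖g z‖ ≤ M)
    {w : ℂ} (hw : 0 < w.im) : poissonIntegral (fun t => g t) w = g w := by
  have hopen : IsOpen {z : ℂ | 0 < z.im} := isOpen_lt continuous_const Complex.continuous_im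
  have hnhds : {z : ℂ | 0 < z.im} ∈ 𝓝 w := hopen.mem_nhds hw
  have hnhds' : {z : ℂ | 0 ≤ z.im} ∈ 𝓝 w := mem_of_superset hnhds fun z (hz : 0 < z.im) => hz.le
  have hne : ∀ z : ℂ, 0 ≤ z.im → z - starRingEnd ℂ w ≠ 0 := by
    intro z hz h0
    have := congrArg Complex.im h0
    simp at this
    linarith
  have hM0 : 0 ≤ M := (norm_nonneg _).trans (hM w hw.le)
  have hnorm : ∀ t : ℝ, ((t : ℂ) - w) * (t - starRingEnd ℂ w) = ((‖w - t‖ ^ 2 : ℝ) : ℂ) := by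
    intro t
    rw [← Complex.normSq_eq_norm_sq, Complex.normSq_eq_conj_mul_self]
    simp only [map_sub, Complex.conj_ofReal]
    ring
  -- The product of `t - w` and `t - conj w` is `|w - t| ^ 2`, so the Poisson kernel appears on the
  -- line; `dslope` removes the singularity at `w`.
  have hline : ∀ t : ℝ, dslope g w t * (t - starRingEnd ℂ w)⁻¹ =
      ((Real.pi / w.im : ℝ) : ℂ) * ((kernel w t : ℂ) * (g t - g w)) := by
    intro t
    have ht : (t : ℂ) ≠ w := fun h => by
      have := congrArg Complex.im h
      simp at this
      linarith
    rw [dslope_of_ne _ ht, slope_def_field, div_mul_eq_mul_div, div_eq_mul_inv, mul_assoc,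
      ← mul_inv, mul_comm (_ - starRingEnd ℂ w), hnorm, kernel_eq_normSq]
    have : (w.im : ℂ) ≠ 0 := by exact_mod_cast hw.ne'
    have : (Real.pi : ℂ) ≠ 0 := by exact_mod_cast Real.pi_ne_zero
    push_cast
    field_simp
  have hgt : Continuous fun t : ℝ => g t :=
    hc.comp_continuous Complex.continuous_ofReal fun t => by simp
  have hint : Integrable fun t : ℝ => (kernel w t : ℂ) * (g t - g w) := by
    refine (integrable_kernel hw).ofReal.mul_bdd (c := M + M)
      (hgt.sub continuous_const).aestronglyMeasurable (Eventually.of_forall fun t => ?_)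
    exact (norm_sub_le _ _).trans (add_le_add (hM _ (by simp)) (hM _ hw.le))
  -- For `‖z‖ ≥ 2‖w‖` both `w` and its conjugate are at distance at least `‖z‖ / 2` from `z`, whence
  -- `8 * M`.
  have h0 := integral_ofReal_eq_zero_of_decay
    (h := fun z => dslope g w z * (z - starRingEnd ℂ w)⁻¹) (C := 8 * M) (R₀ := 2 * ‖w‖)
    ?_ ?_ ?_ ?_
  · simp_rw [hline] at h0
    rw [integral_const_mul, mul_eq_zero_iff_left (by
      rw [ne_eq, Complex.ofReal_eq_zero]; exact (div_pos Real.pi_pos hw).ne')] at h0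
    simp_rw [mul_sub] at h0
    have i1 : Integrable fun t : ℝ => (kernel w t : ℂ) * g t :=
      (integrable_kernel hw).ofReal.mul_bdd (c := M) hgt.aestronglyMeasurable
        (Eventually.of_forall fun t => hM _ (by simp))
    have i0 : Integrable fun t : ℝ => (kernel w t : ℂ) := (integrable_kernel hw).ofReal
    rw [integral_sub i1 (i0.mul_const _), integral_mul_const,
      integral_complex_ofReal, integral_kernel hw, sub_eq_zero] at h0
    rw [poissonIntegral_eq, h0]
    simp
  · refine ContinuousOn.mul ((continuousOn_dslope hnhds').2 ⟨hc, hd.differentiableAt hnhds⟩) ?_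
    exact (continuousOn_id.sub continuousOn_const).inv₀ hne
  · refine DifferentiableOn.mul ((Complex.differentiableOn_dslope hnhds).2 hd) ?_
    exact (differentiableOn_id.sub (differentiableOn_const _)).inv fun z hz => hne z (le_of_lt hz)
  · intro z hz hzR
    have hwpos : 0 < ‖w‖ := norm_pos_iff.2 fun h => by simp [h] at hw
    have hzpos : 0 < ‖z‖ := by linarith
    have b1 : ‖z‖ / 2 ≤ ‖z - w‖ := by have := norm_sub_norm_le z w; linarith
    have b2 : ‖z‖ / 2 ≤ ‖z - starRingEnd ℂ w‖ := by
      have := norm_sub_norm_le z (starRingEnd ℂ w)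
      rw [RCLike.norm_conj] at this
      linarith
    have hzw : z ≠ w := fun h => by rw [h] at hzR; linarith
    rw [dslope_of_ne _ hzw, slope_def_field, norm_mul, norm_div, norm_inv]
    calc ‖g z - g w‖ / ‖z - w‖ * ‖z - starRingEnd ℂ w‖⁻¹
        ≤ (M + M) / (‖z‖ / 2) * (‖z‖ / 2)⁻¹ := by
          gcongr
          exact (norm_sub_le _ _).trans (add_le_add (hM _ hz) (hM _ hw.le))
      _ = 8 * M / ‖z‖ ^ 2 := by field_simp; ring
  · simp_rw [hline]
    exact hint.const_mul _

/-! ### Mean value inequalities and domination of Hardy functions by Poisson integrals. -/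

lemma isOpen_upperHalfPlaneSet : IsOpen upperHalfPlaneSet :=
  isOpen_lt continuous_const Complex.continuous_im

/-- Mean value inequality for `‖F‖ ^ q` on circles. -/
lemma rpow_enorm_le_lintegral_circle {F : ℂ → ℂ} {w : ℂ} {R r : ℝ}
    (hF : DifferentiableOn ℂ F (Metric.ball w R)) (hr : 0 < r) (hrR : r < R) {q : ℝ} (hq : 1 ≤ q) :
    ENNReal.ofReal (2 * Real.pi) * ‖F w‖ₑ ^ q ≤
      ∫⁻ θ in Set.Ioo (-Real.pi) Real.pi, ‖F (circleMap w r θ)‖ₑ ^ q := by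
  have hpi := Real.pi_pos
  have hsub : Metric.closedBall w |r| ⊆ Metric.ball w R := by
    rw [abs_of_pos hr]; exact Metric.closedBall_subset_ball hrR
  have h1 : Real.circleAverage F w r = F w :=
    DiffContOnCl.circleAverage ((hF.mono hsub).diffContOnCl_ball subset_rfl)
  rw [Real.circleAverage_eq_integral_add (-Real.pi),
    intervalIntegral.integral_comp_add_right (fun θ => F (circleMap w r θ)),
    intervalIntegral.integral_of_le (by linarith), integral_Ioc_eq_integral_Ioo] at h1
  rw [show 0 + -Real.pi = -Real.pi by ring, show 2 * Real.pi + -Real.pi = Real.pi by ring] at h1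
  have hne : ENNReal.ofReal (2 * Real.pi) ≠ 0 := by simpa using hpi
  set μ : Measure ℝ := (ENNReal.ofReal (2 * Real.pi))⁻¹ •
    volume.restrict (Set.Ioo (-Real.pi) Real.pi) with hμ
  have : IsProbabilityMeasure μ := ⟨by
    rw [hμ, Measure.smul_apply, Measure.restrict_apply_univ, Real.volume_Ioo, sub_neg_eq_add,
      ← two_mul, smul_eq_mul, ENNReal.inv_mul_cancel hne ENNReal.ofReal_ne_top]⟩
  have h2 : ∫ θ, F (circleMap w r θ) ∂μ = F w := by
    rw [hμ, integral_smul_measure, ENNReal.toReal_inv, ENNReal.toReal_ofReal (by positivity), h1]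
  have hcont : Continuous fun θ => F (circleMap w r θ) := by
    refine hF.continuousOn.comp_continuous (continuous_circleMap w r) fun θ => ?_
    exact hsub (Metric.sphere_subset_closedBall (circleMap_mem_sphere' w r θ))
  have h3 := rpow_enorm_integral_le (μ := μ) hcont.aestronglyMeasurable hq
  rw [h2, hμ, lintegral_smul_measure, smul_eq_mul] at h3
  calc _ ≤ _ := mul_le_mul_right h3 _
    _ = _ := by rw [← mul_assoc, ENNReal.mul_inv_cancel hne ENNReal.ofReal_ne_top, one_mul]

lemma circleMap_eq_add_polarCoord_symm (w : ℂ) (r θ : ℝ) :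
    circleMap w r θ = w + Complex.polarCoord.symm (r, θ) := by
  rw [Complex.polarCoord_symm_apply, circleMap, Complex.exp_mul_I, Complex.ofReal_cos,
    Complex.ofReal_sin]

/-- Mean value inequality for `‖F‖ ^ q` on discs, with a rough constant. -/
lemma rpow_enorm_le_lintegral_ball {F : ℂ → ℂ} {w : ℂ} {R : ℝ} (hR : 0 < R)
    (hF : DifferentiableOn ℂ F (Metric.ball w R)) {q : ℝ} (hq : 1 ≤ q) :
    ENNReal.ofReal (R / 2) * (ENNReal.ofReal (R / 2) *
      (ENNReal.ofReal (2 * Real.pi) * ‖F w‖ₑ ^ q)) ≤ ∫⁻ z in Metric.ball w R, ‖F z‖ₑ ^ q := by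
  have hq0 : 0 ≤ q := by linarith
  -- Only the outer annulus is kept: there the polar weight `r` is at least `R / 2`, and the radial
  -- interval has length `R / 2`.
  set S := Set.Ioo (R / 2) R ×ˢ Set.Ioo (-Real.pi) Real.pi with hS
  have hSm : MeasurableSet S := measurableSet_Ioo.prod measurableSet_Ioo
  have hmem : ∀ x ∈ S, w + Complex.polarCoord.symm x ∈ Metric.ball w R := by
    intro x hx
    have : 0 < x.1 := (half_pos hR).trans hx.1.1
    rw [Metric.mem_ball, dist_eq_norm, add_sub_cancel_left, Complex.norm_polarCoord_symm,
      abs_of_pos this]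
    exact hx.1.2
  have hcont : ContinuousOn (fun x : ℝ × ℝ => ENNReal.ofReal x.1 *
      ‖F (w + Complex.polarCoord.symm x)‖ₑ ^ q) S := by
    have h1 : ContinuousOn (fun x : ℝ × ℝ => F (w + Complex.polarCoord.symm x)) S := by
      refine hF.continuousOn.comp (Continuous.continuousOn ?_) hmem
      simp only [Complex.polarCoord_symm_apply]
      fun_prop
    have h2 : ContinuousOn (fun x : ℝ × ℝ => ‖x.1‖₊ * ‖F (w + Complex.polarCoord.symm x)‖₊ ^ q) S :=
      (by fun_prop : ContinuousOn (fun x : ℝ × ℝ => ‖x.1‖₊) S).mul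
        ((NNReal.continuous_rpow_const hq0).comp_continuousOn h1.nnnorm)
    refine (ENNReal.continuous_coe.comp_continuousOn h2).congr fun x hx => ?_
    have : 0 < x.1 := (half_pos hR).trans hx.1.1
    simp only [Function.comp_apply, ENNReal.coe_mul]
    rw [ENNReal.coe_rpow_of_nonneg _ hq0, ← enorm_eq_nnnorm, ← enorm_eq_nnnorm,
      Real.enorm_of_nonneg this.le]
  have e1 : ∫⁻ z in Metric.ball w R, ‖F z‖ₑ ^ q =
      ∫⁻ z, (Metric.ball w R).indicator (fun z => ‖F z‖ₑ ^ q) (w + z) := by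
    rw [lintegral_add_left_eq_self, lintegral_indicator Metric.isOpen_ball.measurableSet]
  rw [e1, ← Complex.lintegral_comp_polarCoord_symm]
  calc _ = ∫⁻ r in Set.Ioo (R / 2) R, ENNReal.ofReal (R / 2) *
      (ENNReal.ofReal (2 * Real.pi) * ‖F w‖ₑ ^ q) := by
        rw [lintegral_const, Measure.restrict_apply_univ, Real.volume_Ioo, mul_comm,
          show R - R / 2 = R / 2 by ring]
    _ ≤ ∫⁻ r in Set.Ioo (R / 2) R, ∫⁻ θ in Set.Ioo (-Real.pi) Real.pi,
        ENNReal.ofReal r * ‖F (w + Complex.polarCoord.symm (r, θ))‖ₑ ^ q := by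
        refine setLIntegral_mono' measurableSet_Ioo fun r hr => ?_
        have hr0 : 0 < r := (half_pos hR).trans hr.1
        rw [lintegral_const_mul' _ _ ENNReal.ofReal_ne_top]
        refine mul_le_mul' (ENNReal.ofReal_le_ofReal hr.1.le) ?_
        simp_rw [← circleMap_eq_add_polarCoord_symm]
        exact rpow_enorm_le_lintegral_circle hF hr0 hr.2 hq
    _ = ∫⁻ x in S, ENNReal.ofReal x.1 * ‖F (w + Complex.polarCoord.symm x)‖ₑ ^ q := by
        have hm := hcont.aemeasurable (μ := volume) hSm
        rw [hS, Measure.volume_eq_prod, ← Measure.prod_restrict] at hm ⊢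
        rw [lintegral_prod _ hm]
    _ = ∫⁻ x in S, ENNReal.ofReal x.1 • (Metric.ball w R).indicator (fun z => ‖F z‖ₑ ^ q)
          (w + Complex.polarCoord.symm x) := by
        refine setLIntegral_congr_fun hSm fun x hx => ?_
        simp only [smul_eq_mul]
        rw [Set.indicator_of_mem (hmem x hx)]
    _ ≤ _ := by
        refine lintegral_mono_set fun x hx => ?_
        rw [polarCoord_target]
        exact ⟨(half_pos hR).trans hx.1.1, hx.2⟩

/-- A function with bounded `L ^ q` norms on horizontal lines has bounded area integrals. -/
lemma lintegral_ball_le {F : ℂ → ℂ} {w : ℂ} {R : ℝ} (hR : R ≤ w.im)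
    (hF : ContinuousOn F (Metric.ball w R)) {q : ℝ} (hq : 1 ≤ q) {B : ℝ≥0∞}
    (hB : ∀ y : ℝ, 0 < y → ∫⁻ x : ℝ, ‖F (x + y * Complex.I)‖ₑ ^ q ≤ B) :
    ∫⁻ z in Metric.ball w R, ‖F z‖ₑ ^ q ≤ B * ENNReal.ofReal (2 * R) := by
  have hq0 : 0 ≤ q := by linarith
  set G := (Metric.ball w R).indicator fun z => ‖F z‖ₑ ^ q with hG
  have hGm : AEMeasurable G volume := by
    rw [aemeasurable_indicator_iff Metric.isOpen_ball.measurableSet]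
    exact (hF.aemeasurable Metric.isOpen_ball.measurableSet).enorm.pow_const q
  rw [← lintegral_indicator Metric.isOpen_ball.measurableSet, ← hG,
    ← Complex.volume_preserving_equiv_real_prod.symm.lintegral_comp_emb
      Complex.measurableEquivRealProd.symm.measurableEmbedding]
  have hm : AEMeasurable (fun a => G (Complex.measurableEquivRealProd.symm a)) volume :=
    hGm.comp_quasiMeasurePreserving
      Complex.volume_preserving_equiv_real_prod.symm.quasiMeasurePreserving
  rw [Measure.volume_eq_prod] at hm ⊢
  rw [lintegral_prod_symm _ hm]
  calc _ ≤ ∫⁻ y in Set.Ioo (w.im - R) (w.im + R), B := by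
        rw [← lintegral_indicator measurableSet_Ioo]
        refine lintegral_mono fun y => ?_
        by_cases hy : y ∈ Set.Ioo (w.im - R) (w.im + R)
        · rw [Set.indicator_of_mem hy]
          refine le_trans (lintegral_mono fun x => ?_) (hB y (by linarith [hy.1]))
          rw [hG, Complex.measurableEquivRealProd_symm_apply, Complex.mk_eq_add_mul_I]
          exact Set.indicator_le_self _ _ _
        · rw [Set.indicator_of_notMem hy]
          refine le_of_eq ((lintegral_congr fun x => ?_).trans lintegral_zero)
          rw [hG, Set.indicator_of_notMem]
          intro hmem
          apply hy
          rw [Metric.mem_ball, dist_eq_norm] at hmem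
          have := (Complex.abs_im_le_norm _).trans_lt hmem
          rw [Complex.sub_im, Complex.measurableEquivRealProd_symm_apply, abs_lt] at this
          exact ⟨by linarith [this.1], by linarith [this.2]⟩
    _ = _ := by
        rw [lintegral_const, Measure.restrict_apply_univ, Real.volume_Ioo]
        congr 2
        ring

/-- Above height `ε` the disc of radius `ε` stays in the half-plane, so the area mean value
inequality applies with a constant independent of the centre. This boundedness makes the Poisson
formula available for shifted Hardy functions. -/
lemma exists_bound_of_lintegral_le {F : ℂ → ℂ} (hF : DifferentiableOn ℂ F upperHalfPlaneSet)
    {q : ℝ} (hq : 1 ≤ q) {B : ℝ≥0∞} (hBtop : B ≠ ∞)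
    (hB : ∀ y : ℝ, 0 < y → ∫⁻ x : ℝ, ‖F (x + y * Complex.I)‖ₑ ^ q ≤ B) {ε : ℝ} (hε : 0 < ε) :
    ∃ M : ℝ, ∀ z : ℂ, ε ≤ z.im → ‖F z‖ ≤ M := by
  have hq0 : 0 < q := by linarith
  set D : ℝ≥0∞ := (ENNReal.ofReal (ε / 2) * (ENNReal.ofReal (ε / 2) *
    ENNReal.ofReal (2 * Real.pi)))⁻¹ * (B * ENNReal.ofReal (2 * ε)) with hD
  have hc0 : ENNReal.ofReal (ε / 2) * (ENNReal.ofReal (ε / 2) *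
    ENNReal.ofReal (2 * Real.pi)) ≠ 0 := by simp [hε, Real.pi_pos]
  have hct : ENNReal.ofReal (ε / 2) * (ENNReal.ofReal (ε / 2) *
    ENNReal.ofReal (2 * Real.pi)) ≠ ∞ := by finiteness
  have hDtop : D ≠ ∞ := by
    rw [hD]; exact ENNReal.mul_ne_top (ENNReal.inv_ne_top.2 hc0) (by finiteness)
  refine ⟨(D ^ (1 / q)).toReal, fun z hz => ?_⟩
  have hsub : Metric.ball z ε ⊆ upperHalfPlaneSet := by
    intro v hv
    rw [Metric.mem_ball, dist_eq_norm] at hv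
    have := (abs_lt.1 ((Complex.abs_im_le_norm _).trans_lt hv)).1
    rw [Complex.sub_im] at this
    show 0 < v.im
    linarith
  have h1 := (rpow_enorm_le_lintegral_ball hε (hF.mono hsub) hq).trans
    (lintegral_ball_le hz (hF.mono hsub).continuousOn hq hB)
  rw [← mul_assoc, ← mul_assoc, ENNReal.mul_le_iff_le_inv (by rwa [mul_assoc]) (by rwa [mul_assoc]),
    mul_assoc, ← hD] at h1
  have h2 := ENNReal.rpow_le_rpow h1 (one_div_nonneg.2 hq0.le)
  rw [← ENNReal.rpow_mul, mul_one_div_cancel hq0.ne', ENNReal.rpow_one] at h2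
  rw [← toReal_enorm]
  exact ENNReal.toReal_mono (by finiteness) h2

/-- `‖F‖ ^ q` is dominated by the Poisson integral of its values on a lower horizontal line. -/
lemma rpow_enorm_le_lintegral_kernel {F : ℂ → ℂ} (hF : DifferentiableOn ℂ F upperHalfPlaneSet)
    {ε M : ℝ} (hε : 0 < ε) (hM : ∀ z : ℂ, ε ≤ z.im → ‖F z‖ ≤ M) {q : ℝ} (hq : 1 ≤ q) {w : ℂ}
    (hw : 0 < w.im) :
    ‖F (w + ε * Complex.I)‖ₑ ^ q ≤
      ∫⁻ t, ENNReal.ofReal (kernel w t) * ‖F (t + ε * Complex.I)‖ₑ ^ q := by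
  have hmaps : ∀ z : ℂ, 0 ≤ z.im → z + ε * Complex.I ∈ upperHalfPlaneSet := by
    intro z hz
    show 0 < (z + ε * Complex.I).im
    simp only [Complex.add_im, Complex.mul_im, Complex.ofReal_re, Complex.I_im, mul_one,
      Complex.ofReal_im, Complex.I_re, mul_zero, add_zero]
    linarith
  have hd : DifferentiableOn ℂ (fun z => F (z + ε * Complex.I)) {z | 0 ≤ z.im} :=
    hF.comp (by fun_prop) hmaps
  have h := poissonIntegral_ofReal_eq hd.continuousOn
    (hd.mono fun z (hz : 0 < z.im) => hz.le) (M := M) (fun z hz => hM _ (by simpa using hz)) hw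
  rw [← h]
  refine rpow_enorm_poissonIntegral_le hw ?_ hq
  exact (hd.continuousOn.comp_continuous Complex.continuous_ofReal
    fun t => by simp).aestronglyMeasurable

/-! ### Uniform integral bounds for Poisson kernels composed with `φ`. -/

lemma add_mul_I_im (z : ℂ) (y : ℝ) : (z + y * Complex.I).im = z.im + y := by simp

lemma add_mul_I_mem {z : ℂ} {y : ℝ} (h : 0 < z.im + y) : z + y * Complex.I ∈ upperHalfPlaneSet := by
  show 0 < (z + y * Complex.I).im
  rwa [add_mul_I_im]

/-- If `φ` grows at least linearly on the imaginary axis then the Poisson kernels, composed with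
`φ` on a horizontal line, have bounded integrals. -/
lemma lintegral_kernel_comp_le {φ : ℂ → ℂ} (hd : DifferentiableOn ℂ φ upperHalfPlaneSet)
    (hm : Set.MapsTo φ upperHalfPlaneSet upperHalfPlaneSet) {c : ℝ} (hc : 0 < c)
    (hgrowth : ∀ᶠ Y : ℝ in atTop, c * Y ≤ ‖φ (Y * Complex.I)‖) {y δ : ℝ} (hy : 0 < y)
    (hδ : 0 < δ) (t : ℝ) :
    ∫⁻ x : ℝ, ENNReal.ofReal (kernel (φ (x + y * Complex.I) + δ * Complex.I) t) ≤
      ENNReal.ofReal (4 / c) := by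
  have hpi := Real.pi_pos
  have hmaps : Set.MapsTo (fun z : ℂ => z + y * Complex.I) {z | 0 ≤ z.im} upperHalfPlaneSet :=
    fun z (hz : 0 ≤ z.im) => add_mul_I_mem (by linarith)
  have him : ∀ z : ℂ, 0 ≤ z.im → δ < (φ (z + y * Complex.I) + δ * Complex.I).im := by
    intro z hz
    have : 0 < (φ (z + y * Complex.I)).im := hm (hmaps hz)
    rw [add_mul_I_im]
    linarith
  -- The shift by `y` makes `g` continuous up to the real line; the shift by `δ` bounds it by `1 /
  -- δ`.
  set g : ℂ → ℂ := fun z => -1 / (φ (z + y * Complex.I) + δ * Complex.I - t) with hg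
  have hden : ∀ z : ℂ, 0 ≤ z.im → δ ≤ ‖φ (z + y * Complex.I) + δ * Complex.I - t‖ := by
    intro z hz
    refine le_trans ?_ (Complex.abs_im_le_norm _)
    rw [Complex.sub_im, Complex.ofReal_im, sub_zero]
    exact (him z hz).le.trans (le_abs_self _)
  have hgd : DifferentiableOn ℂ g {z | 0 ≤ z.im} := by
    refine DifferentiableOn.div (differentiableOn_const _) ?_ fun z hz =>
      norm_pos_iff.1 (hδ.trans_le (hden z hz))
    exact ((hd.comp (by fun_prop) hmaps).add_const _).sub_const _
  have hgb : ∀ z : ℂ, 0 ≤ z.im → ‖g z‖ ≤ 1 / δ := by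
    intro z hz
    rw [hg, norm_div, norm_neg, norm_one]
    exact one_div_le_one_div_of_le hδ (hden z hz)
  set k : ℝ → ℝ := fun x => kernel (φ (x + y * Complex.I) + δ * Complex.I) t with hk
  have hgk : ∀ x : ℝ, (g x).im = Real.pi * k x := by
    intro x
    rw [hk]
    simp only
    rw [kernel_eq_im_div, hg]
    field_simp
  have hk0 : ∀ x, 0 ≤ k x := fun x => kernel_nonneg (hδ.le.trans (him x (by simp)).le) t
  have hgc : Continuous fun x : ℝ => g x :=
    hgd.continuousOn.comp_continuous Complex.continuous_ofReal fun x => by simp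
  have hkc : Continuous k := by
    have : k = fun x : ℝ => Real.pi⁻¹ * (g x).im := by
      ext x; rw [hgk]; field_simp
    rw [this]
    exact continuous_const.mul (Complex.continuous_im.comp hgc)
  have hint : ∀ n : ℕ, 0 < n → Integrable (fun x : ℝ => kernel (n * Complex.I) x * k x) ∧
      ∫ x : ℝ, kernel (n * Complex.I) x * k x = Real.pi⁻¹ * (g (n * Complex.I)).im := by
    intro n hn
    have hw : 0 < ((n : ℂ) * Complex.I).im := by simpa using hn
    have h1 := poissonIntegral_ofReal_eq hgd.continuousOn
      (hgd.mono fun z (hz : 0 < z.im) => hz.le) hgb hw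
    have i0 : Integrable fun x : ℝ => (kernel (n * Complex.I) x : ℂ) :=
      (integrable_kernel hw).ofReal
    have i1 : Integrable fun x : ℝ => (kernel (n * Complex.I) x : ℂ) * g x :=
      i0.mul_bdd hgc.aestronglyMeasurable (Eventually.of_forall fun x => hgb x (by simp))
    have e : ∀ x : ℝ, kernel (n * Complex.I) x * k x =
        Real.pi⁻¹ * ((kernel (n * Complex.I) x : ℂ) * g x).im := by
      intro x
      rw [Complex.im_ofReal_mul, hgk]
      field_simp
    have i2 : Integrable fun x : ℝ => ((kernel (n * Complex.I) x : ℂ) * g x).im := i1.im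
    simp_rw [e]
    refine ⟨i2.const_mul _, ?_⟩
    rw [integral_const_mul, ← h1, poissonIntegral_eq]
    congr 1
    exact integral_im i1
  -- The weight `2πn * kernel (in) x` equals `2n² / (x² + n²)`, which is at least `1` once `n ≥
  -- |x|`, so Fatou recovers the unweighted integral.
  refine lintegral_le_of_le_liminf
    (g := fun n x => ENNReal.ofReal (2 * Real.pi * n * (kernel (n * Complex.I) x * k x)))
    (fun n => ?_) ?_ (Eventually.of_forall fun x => ?_)
  · exact (((measurable_kernel_right _).mul hkc.measurable).const_mul _).ennreal_ofReal.aemeasurable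
  · have hg' : ∀ᶠ n : ℕ in atTop, c * ((n : ℝ) + y) ≤ ‖φ (((n : ℝ) + y : ℝ) * Complex.I)‖ :=
      (tendsto_atTop_add_const_right _ y tendsto_natCast_atTop_atTop).eventually hgrowth
    -- Beyond `2 (δ + |t|) / c`, the terms `δ` and `t` take away at most half of the growth `c * n`.
    filter_upwards [hg', eventually_gt_atTop 0,
      tendsto_natCast_atTop_atTop.eventually_ge_atTop (2 * (δ + |t|) / c)] with n h1 h2 h3
    have hn : (0 : ℝ) < n := by exact_mod_cast h2
    rw [← ofReal_integral_eq_lintegral_ofReal ((hint n h2).1.const_mul _)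
      (Eventually.of_forall fun x => mul_nonneg (by positivity)
        (mul_nonneg (kernel_nonneg (by simp) x) (hk0 x))), integral_const_mul, (hint n h2).2]
    refine ENNReal.ofReal_le_ofReal ?_
    have e1 : 2 * Real.pi * n * (Real.pi⁻¹ * (g (n * Complex.I)).im) =
        2 * n * (g (n * Complex.I)).im := by field_simp
    rw [e1]
    have h4 : c * n / 2 ≤ ‖φ (n * Complex.I + y * Complex.I) + δ * Complex.I - t‖ := by
      have e2 : (((n : ℝ) + y : ℝ) : ℂ) * Complex.I = n * Complex.I + y * Complex.I := by
        push_cast; ring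
      rw [e2] at h1
      have h5 := norm_sub_le (φ (n * Complex.I + y * Complex.I) + δ * Complex.I - t)
        (δ * Complex.I - t)
      have h6 := norm_sub_le ((δ : ℂ) * Complex.I) t
      rw [norm_mul, Complex.norm_I, Complex.norm_real, Complex.norm_real, mul_one,
        Real.norm_eq_abs, Real.norm_eq_abs, abs_of_pos hδ] at h6
      rw [show φ (n * Complex.I + y * Complex.I) + δ * Complex.I - t - (δ * Complex.I - t) =
        φ (n * Complex.I + y * Complex.I) by ring] at h5
      rw [div_le_iff₀ hc] at h3
      nlinarith [mul_pos hc hy]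
    have h7 : (g (n * Complex.I)).im ≤ 1 / (c * n / 2) := by
      refine (le_abs_self _).trans ((Complex.abs_im_le_norm _).trans ?_)
      rw [hg, norm_div, norm_neg, norm_one]
      exact one_div_le_one_div_of_le (by positivity) h4
    calc _ ≤ 2 * n * (1 / (c * n / 2)) := by gcongr
      _ = 4 / c := by field_simp; norm_num
  · refine le_liminf_of_le (by isBoundedDefault) ?_
    filter_upwards [eventually_gt_atTop 0,
      tendsto_natCast_atTop_atTop.eventually_ge_atTop |x|] with n h1 h2
    have hn : (0 : ℝ) < n := by exact_mod_cast h1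
    refine ENNReal.ofReal_le_ofReal ?_
    have h3 : 1 ≤ 2 * Real.pi * n * kernel (n * Complex.I) x := by
      have e : 2 * Real.pi * n * kernel (n * Complex.I) x = 2 * n ^ 2 / (x ^ 2 + n ^ 2) := by
        simp only [kernel, Complex.mul_im, Complex.mul_re, Complex.natCast_re, Complex.natCast_im,
          Complex.I_re, Complex.I_im]
        field_simp
        simp
      rw [e, le_div_iff₀ (by positivity)]
      have := sq_le_sq' (by linarith [abs_nonneg x]) h2
      rw [sq_abs] at this
      linarith
    calc kernel (φ (x + y * Complex.I) + δ * Complex.I) t = 1 * k x := by rw [one_mul]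
      _ ≤ _ := by
        rw [← mul_assoc]
        exact mul_le_mul_of_nonneg_right h3 (hk0 x)

lemma tendsto_one_div_add_one : Tendsto (fun n : ℕ => (1 : ℝ) / (n + 1)) atTop (𝓝[>] 0) :=
  tendsto_nhdsWithin_iff.2 ⟨tendsto_one_div_add_atTop_nhds_zero_nat,
    Eventually.of_forall fun n => show (0 : ℝ) < 1 / (n + 1) by positivity⟩

lemma aemeasurable_kernel_comp {ψ : ℝ → ℂ} (hψ : AEMeasurable ψ) (t : ℝ) :
    AEMeasurable fun x => ENNReal.ofReal (kernel (ψ x) t) :=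
  (measurable_kernel.comp_aemeasurable (hψ.prodMk aemeasurable_const)).ennreal_ofReal

/-- Removes the shift `δ`: once `δ ≤ Im ψ x`, the unshifted kernel is at most twice the shifted one.
Where `ψ` is real the kernel is zero by its formula. -/
lemma lintegral_kernel_comp_le_of_add {ψ : ℝ → ℂ} (hψ : AEMeasurable ψ) (h0 : ∀ᵐ x, 0 ≤ (ψ x).im)
    {t : ℝ} {B : ℝ≥0∞}
    (hB : ∀ δ : ℝ, 0 < δ → ∫⁻ x, ENNReal.ofReal (kernel (ψ x + δ * Complex.I) t) ≤ B) :
    ∫⁻ x, ENNReal.ofReal (kernel (ψ x) t) ≤ 2 * B := by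
  refine lintegral_le_of_le_liminf
    (g := fun n x => 2 * ENNReal.ofReal (kernel (ψ x + (1 / (n + 1) : ℝ) * Complex.I) t))
    (fun n => (aemeasurable_kernel_comp (hψ.add_const _) t).const_mul _)
    (Eventually.of_forall fun n => ?_) (h0.mono fun x hx => ?_)
  · rw [lintegral_const_mul' _ _ (by simp)]
    exact mul_le_mul_right (hB _ (by positivity)) _
  · rcases hx.eq_or_lt with h | h
    · simp [kernel, ← h]
    · refine le_liminf_of_le (by isBoundedDefault) ?_
      filter_upwards [(tendsto_one_div_add_one.mono_right nhdsWithin_le_nhds).eventually_le_const h]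
        with n hn
      rw [← ENNReal.ofReal_ofNat, ← ENNReal.ofReal_mul (by norm_num)]
      refine ENNReal.ofReal_le_ofReal ((kernel_le_kernel_add h
        (δ := 1 / (n + 1)) (by positivity) t).trans ?_)
      refine mul_le_mul_of_nonneg_right ?_ (kernel_nonneg ?_ t)
      · rw [div_le_iff₀ h]; linarith
      · rw [add_mul_I_im]; positivity

lemma continuousAt_kernel {z : ℂ} (hz : 0 < z.im) (t : ℝ) : ContinuousAt (kernel · t) z := by
  unfold kernel
  refine continuousAt_const.mul (Complex.continuous_im.continuousAt.div ?_ (by positivity))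
  fun_prop

/-- Passage to boundary values in the bound for Poisson kernels. -/
lemma lintegral_kernel_boundary_le {φ : ℂ → ℂ} (hd : ContinuousOn φ upperHalfPlaneSet)
    {ψ : ℝ → ℂ} (h0 : ∀ᵐ x, 0 ≤ (ψ x).im)
    (hψ : ∀ᵐ x : ℝ, Tendsto (fun y : ℝ => φ (x + y * Complex.I)) (𝓝[>] 0) (𝓝 (ψ x)))
    {t δ : ℝ} (hδ : 0 < δ) {B : ℝ≥0∞}
    (hB : ∀ y : ℝ, 0 < y →
      ∫⁻ x : ℝ, ENNReal.ofReal (kernel (φ (x + y * Complex.I) + δ * Complex.I) t) ≤ B) :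
    ∫⁻ x, ENNReal.ofReal (kernel (ψ x + δ * Complex.I) t) ≤ B := by
  refine lintegral_le_of_le_liminf (g := fun n x => ENNReal.ofReal (kernel
      (φ (x + (1 / (n + 1) : ℝ) * Complex.I) + δ * Complex.I) t)) (fun n => ?_)
    (Eventually.of_forall fun n => hB _ (by positivity)) ?_
  · refine aemeasurable_kernel_comp (Measurable.aemeasurable (Continuous.measurable ?_)) t
    refine (hd.comp_continuous (by fun_prop) fun x => add_mul_I_mem ?_).add continuous_const
    rw [Complex.ofReal_im, zero_add]; positivity
  · filter_upwards [h0, hψ] with x h1 h2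
    have h3 := (h2.comp tendsto_one_div_add_one).add_const (δ * Complex.I)
    refine (Tendsto.liminf_eq (ENNReal.tendsto_ofReal
      ((continuousAt_kernel ?_ t).tendsto.comp h3))).ge
    rw [add_mul_I_im]; positivity

/-! ### Growth and boundary values of the quotient. -/

lemma tendsto_powerSum_div {ι : Type*} {l : Filter ι} {f : ι → ℂ} {m : ℕ} (c : Fin (m + 1) → ℂ)
    {e : Fin (m + 1) → ℝ} (he : StrictAnti e) (hf : Tendsto (fun i => ‖f i‖) l atTop) :
    Tendsto (fun i => powerSum c e (f i) / f i ^ ((e 0 : ℝ) : ℂ)) l (𝓝 (c 0)) := by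
  have h1 : ∀ j : Fin (m + 1), Tendsto (fun i => c j * f i ^ ((e j : ℝ) : ℂ) /
      f i ^ ((e 0 : ℝ) : ℂ)) l (𝓝 (if j = 0 then c 0 else 0)) := by
    intro j
    have hne : ∀ᶠ i in l, f i ≠ 0 := (hf.eventually_gt_atTop 0).mono fun i hi => norm_pos_iff.1 hi
    split_ifs with hj
    · subst hj
      refine tendsto_const_nhds.congr' (hne.mono fun i hi => ?_)
      dsimp only
      rw [mul_div_assoc, div_self, mul_one]
      rw [ne_eq, Complex.cpow_eq_zero_iff]
      exact fun h => hi h.1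
    · have hlt : e j < e 0 := he (Fin.pos_iff_ne_zero.2 hj)
      have h2 : Tendsto (fun i => ‖c j‖ * ‖f i‖ ^ (-(e 0 - e j))) l (𝓝 0) := by
        simpa using ((tendsto_rpow_neg_atTop (sub_pos.2 hlt)).comp hf).const_mul ‖c j‖
      rw [tendsto_zero_iff_norm_tendsto_zero]
      refine h2.congr' (hne.mono fun i hi => ?_)
      dsimp only
      rw [norm_div, norm_mul, Complex.norm_cpow_real, Complex.norm_cpow_real, mul_div_assoc,
        ← Real.rpow_sub (norm_pos_iff.2 hi), neg_sub]
  have h3 := tendsto_finsetSum Finset.univ fun j _ => h1 j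
  simp only [Finset.sum_ite_eq', Finset.mem_univ, if_true] at h3
  refine h3.congr fun i => ?_
  rw [powerSum, Finset.sum_div]

lemma powerSum_ne_zero_of_tendsto {ι : Type*} {l : Filter ι} {f : ι → ℂ} {m : ℕ}
    {c : Fin (m + 1) → ℂ} (hc : c 0 ≠ 0) {e : Fin (m + 1) → ℝ} (he : StrictAnti e)
    (hf : Tendsto (fun i => ‖f i‖) l atTop) : ∀ᶠ i in l, powerSum c e (f i) ≠ 0 := by
  filter_upwards [(tendsto_powerSum_div c he hf).eventually_ne hc] with i hi h
  simp [h] at hi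

section

variable {m n : ℕ} {lam : Fin (m + 1) → ℂ} {a : Fin (m + 1) → ℝ} {mu : Fin (n + 1) → ℂ}
  {b : Fin (n + 1) → ℝ} {φ : ℂ → ℂ}

lemma mul_I_mem {Y : ℝ} (hY : 0 < Y) : Y * Complex.I ∈ upperHalfPlaneSet := by
  show 0 < (Y * Complex.I).im
  simpa using hY

lemma IsQLP.tendsto_norm_div (hφ : IsQLP lam a mu b φ) :
    Tendsto (fun Y : ℝ => ‖φ (Y * Complex.I)‖ / Y ^ (a 0 - b 0)) atTop
      (𝓝 (‖lam 0‖ / ‖mu 0‖)) := by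
  have hf : Tendsto (fun Y : ℝ => ‖(Y : ℂ) * Complex.I‖) atTop atTop := by
    simpa using tendsto_abs_atTop_atTop
  have h1 := ((tendsto_powerSum_div lam hφ.a_strictAnti hf).norm).div
    ((tendsto_powerSum_div mu hφ.b_strictAnti hf).norm) (by simpa using hφ.mu_ne_zero)
  refine h1.congr' ?_
  filter_upwards [powerSum_ne_zero_of_tendsto hφ.mu_ne_zero hφ.b_strictAnti hf,
    eventually_gt_atTop 0] with Y hY hY0
  rw [hφ.eq_div _ (mul_I_mem hY0) hY]
  simp only [Pi.div_apply, norm_div, Complex.norm_cpow_real, norm_mul, Complex.norm_I, Complex.norm_real,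
    mul_one, Real.norm_eq_abs, abs_of_pos hY0]
  rw [Real.rpow_sub hY0]
  have := Real.rpow_pos_of_pos hY0 (a 0)
  have := Real.rpow_pos_of_pos hY0 (b 0)
  have := norm_pos_iff.2 hY
  field_simp

lemma IsQLP.exists_growth_iff (hφ : IsQLP lam a mu b φ) :
    (∃ c : ℝ, 0 < c ∧ ∀ᶠ Y : ℝ in atTop, c * Y ≤ ‖φ (Y * Complex.I)‖) ↔ 1 ≤ a 0 - b 0 := by
  have hL : 0 < ‖lam 0‖ / ‖mu 0‖ :=
    div_pos (norm_pos_iff.2 hφ.lam_ne_zero) (norm_pos_iff.2 hφ.mu_ne_zero)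
  constructor
  · rintro ⟨c, hc, h⟩
    by_contra! hlt
    have h1 := hφ.tendsto_norm_div.mul (tendsto_rpow_neg_atTop (sub_pos.2 hlt))
    rw [mul_zero] at h1
    refine absurd (ge_of_tendsto h1 (b := c) ?_) (not_le.2 hc)
    filter_upwards [h, eventually_gt_atTop 0] with Y h2 h3
    rw [div_mul_eq_mul_div, mul_div_assoc, ← Real.rpow_sub h3,
      show -(1 - (a 0 - b 0)) - (a 0 - b 0) = -1 by ring, Real.rpow_neg_one, ← div_eq_mul_inv,
      le_div_iff₀ h3]
    exact h2
  · intro hd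
    refine ⟨‖lam 0‖ / ‖mu 0‖ / 2, half_pos hL, ?_⟩
    filter_upwards [hφ.tendsto_norm_div.eventually_const_le (half_lt_self hL),
      eventually_ge_atTop 1] with Y h1 h2
    have h3 : 0 < Y := by linarith
    rw [le_div_iff₀ (Real.rpow_pos_of_pos h3 _)] at h1
    refine le_trans (mul_le_mul_of_nonneg_left ?_ (half_pos hL).le) h1
    calc Y = Y ^ (1 : ℝ) := (Real.rpow_one Y).symm
      _ ≤ _ := Real.rpow_le_rpow_of_exponent_le h2 hd

/-- The sum is real-analytic on the connected half-line and nonzero far out, where its leading term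
dominates; hence its zero set is codiscretely avoided and null. -/
lemma ae_restrict_powerSum_ne_zero (hc : mu 0 ≠ 0) (he : StrictAnti b) :
    ∀ᵐ x : ℝ ∂volume.restrict (Set.Ioi 0), powerSum mu b x ≠ 0 := by
  have h1 : AnalyticOnNhd ℝ (fun x : ℝ => powerSum mu b x) (Set.Ioi 0) := by
    intro x hx
    have h2 : AnalyticAt ℂ (powerSum mu b) (x : ℂ) := by
      unfold powerSum
      refine Finset.analyticAt_fun_sum _ fun j _ => analyticAt_const.mul ?_
      exact analyticAt_id.cpow analyticAt_const (Complex.ofReal_mem_slitPlane.2 hx)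
    exact (h2.restrictScalars (𝕜 := ℝ)).comp (Complex.ofRealCLM.analyticAt x)
  have hf : Tendsto (fun Y : ℝ => ‖(Y : ℂ)‖) atTop atTop := by
    simpa using tendsto_abs_atTop_atTop
  obtain ⟨x, hx, hx0⟩ :=
    ((powerSum_ne_zero_of_tendsto hc he hf).and (eventually_gt_atTop 0)).exists
  exact ae_restrict_le_codiscreteWithin measurableSet_Ioi
    (h1.preimage_zero_mem_codiscreteWithin hx hx0 isConnected_Ioi)

lemma ae_powerSum_ne_zero (hc : mu 0 ≠ 0) (he : StrictAnti b) :
    ∀ᵐ x : ℝ, powerSum mu b x ≠ 0 := by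
  have h1 := (ae_restrict_iff' measurableSet_Ioi).1 (ae_restrict_powerSum_ne_zero hc he)
  -- On the negative axis `x ^ b` is `|x| ^ b * exp (iπb)`, so the sum there is a sum on the
  -- positive axis with rotated coefficients.
  have h2 := (ae_restrict_iff' measurableSet_Ioi).1 (ae_restrict_powerSum_ne_zero
    (mu := fun j => mu j * Complex.exp (Real.pi * Complex.I * (b j : ℝ)))
    (mul_ne_zero hc (Complex.exp_ne_zero _)) he)
  have h3 := (Measure.measurePreserving_neg (volume : Measure ℝ)).quasiMeasurePreserving.ae h2
  filter_upwards [h1, h3, Measure.ae_ne volume (0 : ℝ)] with x h4 h5 h6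
  rcases lt_or_gt_of_ne h6 with h | h
  · convert h5 (neg_pos.2 h : -x ∈ Set.Ioi (0 : ℝ)) using 1
    refine Finset.sum_congr rfl fun j _ => ?_
    rw [Complex.ofReal_cpow_of_nonpos h.le]
    push_cast
    ring
  · exact h4 h

/-- The principal argument is `π` on the negative axis, its limit from above. Thus the closed
formula evaluated at real points gives the true boundary values. -/
lemma continuousWithinAt_log_upper {x : ℝ} (hx : x ≠ 0) :
    ContinuousWithinAt Complex.log upperHalfPlaneSet x := by
  rcases lt_or_gt_of_ne hx with h | h
  · exact (Complex.continuousWithinAt_log_of_re_neg_of_im_zero (z := x) (by simpa) (by simp)).mono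
      fun z (hz : 0 < z.im) => hz.le
  · exact (continuousAt_clog (Complex.ofReal_mem_slitPlane.2 h)).continuousWithinAt

lemma tendsto_powerSum {x : ℝ} (hx : x ≠ 0) (mu : Fin (n + 1) → ℂ) (b : Fin (n + 1) → ℝ) :
    Tendsto (powerSum mu b) (𝓝[upperHalfPlaneSet] x) (𝓝 (powerSum mu b x)) := by
  unfold powerSum
  refine tendsto_finsetSum _ fun j _ => Tendsto.const_mul _ ?_
  have hx' : (x : ℂ) ≠ 0 := by exact_mod_cast hx
  have h1 : Tendsto (fun z => Complex.exp (Complex.log z * (b j : ℝ))) (𝓝[upperHalfPlaneSet] x)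
      (𝓝 (Complex.exp (Complex.log x * (b j : ℝ)))) :=
    Complex.continuous_exp.continuousAt.tendsto.comp
      ((continuousWithinAt_log_upper hx).tendsto.mul_const _)
  rw [Complex.cpow_def_of_ne_zero hx']
  refine h1.congr' ?_
  filter_upwards [self_mem_nhdsWithin] with z hz
  rw [Complex.cpow_def_of_ne_zero]
  rintro rfl
  exact lt_irrefl (0 : ℝ) hz

lemma IsQLP.ae_tendsto (hφ : IsQLP lam a mu b φ) :
    ∀ᵐ x : ℝ, Tendsto φ (𝓝[upperHalfPlaneSet] x) (𝓝 (powerSum lam a x / powerSum mu b x)) := by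
  filter_upwards [ae_powerSum_ne_zero hφ.mu_ne_zero hφ.b_strictAnti,
    Measure.ae_ne volume (0 : ℝ)] with x h1 h2
  refine ((tendsto_powerSum h2 lam a).div (tendsto_powerSum h2 mu b) h1).congr' ?_
  filter_upwards [self_mem_nhdsWithin, (tendsto_powerSum h2 mu b).eventually_ne h1] with z h3 h4
  exact (hφ.eq_div z h3 h4).symm

end

/-! ### Non-tangential limits and norms as integrals. -/

lemma tendsto_vertical_nontangential (x : ℝ) :
    Tendsto (fun y : ℝ => (x : ℂ) + y * Complex.I) (𝓝[>] 0) (nontangential x) := by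
  refine Tendsto.mono_right ?_ (le_iSup₂ (f := fun (α : ℝ) (_ : 0 < α) =>
    𝓝[{z : ℂ | |z.re - x| < α * z.im}] (x : ℂ)) 1 one_pos)
  refine tendsto_nhdsWithin_iff.2 ⟨?_, ?_⟩
  · refine Tendsto.mono_left (Continuous.tendsto' (by fun_prop) _ _ (by simp)) nhdsWithin_le_nhds
  · filter_upwards [self_mem_nhdsWithin] with y hy
    simpa using hy

lemma nontangential_le (x : ℝ) : nontangential x ≤ 𝓝[upperHalfPlaneSet] (x : ℂ) :=
  iSup₂_le fun α hα => nhdsWithin_mono _ fun z (hz : |z.re - x| < α * z.im) =>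
    (mul_pos_iff_of_pos_left hα).1 ((abs_nonneg _).trans_lt hz)

lemma boundaryValue_eq {φ : ℂ → ℂ} {x : ℝ} {l : ℂ}
    (h : Tendsto φ (𝓝[upperHalfPlaneSet] x) (𝓝 l)) : boundaryValue φ x = l := by
  have := (tendsto_vertical_nontangential x).neBot
  exact (h.mono_left (nontangential_le x)).limUnder_eq

lemma tendsto_vertical {φ : ℂ → ℂ} {x : ℝ} {l : ℂ}
    (h : Tendsto φ (𝓝[upperHalfPlaneSet] x) (𝓝 l)) :
    Tendsto (fun y : ℝ => φ (x + y * Complex.I)) (𝓝[>] 0) (𝓝 l) :=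
  (h.mono_left (nontangential_le x)).comp (tendsto_vertical_nontangential x)

lemma measurable_powerSum {m : ℕ} (c : Fin m → ℂ) (e : Fin m → ℝ) :
    Measurable (powerSum c e) := by
  unfold powerSum
  fun_prop

lemma eLpNorm_le_iff_lintegral {p : ℝ≥0∞} (hp : 1 ≤ p) (hp_top : p ≠ ∞) {f : ℝ → ℂ} {D : ℝ≥0∞} :
    eLpNorm f p volume ≤ D ↔ ∫⁻ x, ‖f x‖ₑ ^ p.toReal ≤ D ^ p.toReal := by
  have hp0 : p ≠ 0 := (zero_lt_one.trans_le hp).ne'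
  rw [eLpNorm_eq_lintegral_rpow_enorm_toReal hp0 hp_top, one_div,
    ENNReal.rpow_inv_le_iff (ENNReal.toReal_pos hp0 hp_top)]

lemma hardyNorm_le_iff {p : ℝ≥0∞} (hp : 1 ≤ p) (hp_top : p ≠ ∞) {F : ℂ → ℂ} {D : ℝ≥0∞} :
    hardyNorm F p ≤ D ↔
      ∀ y : ℝ, 0 < y → ∫⁻ x : ℝ, ‖F (x + y * Complex.I)‖ₑ ^ p.toReal ≤ D ^ p.toReal := by
  rw [hardyNorm, iSup₂_le_iff]
  simp_rw [eLpNorm_le_iff_lintegral hp hp_top]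

lemma one_le_toReal {p : ℝ≥0∞} (hp : 1 ≤ p) (hp_top : p ≠ ∞) : 1 ≤ p.toReal := by
  simpa using ENNReal.toReal_mono hp_top hp

lemma exists_mul_rpow_eq (A : ℝ≥0) {q : ℝ} (hq : 1 ≤ q) :
    ∃ C : ℝ≥0, ∀ D : ℝ≥0∞, (A : ℝ≥0∞) * D ^ q = (C * D) ^ q := by
  have hq0 : 0 < q := by linarith
  refine ⟨A ^ q⁻¹, fun D => ?_⟩
  rw [ENNReal.mul_rpow_of_nonneg _ _ hq0.le, ← ENNReal.coe_rpow_of_nonneg _ hq0.le,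
    NNReal.rpow_inv_rpow hq0.ne']

/-! ### From kernel bounds to composition on the Hardy space. -/

lemma aemeasurable_kernel_mul {ψ : ℝ → ℂ} (hψ : AEMeasurable ψ) {h : ℝ → ℝ≥0∞}
    (hh : AEMeasurable h) : AEMeasurable
      (Function.uncurry fun x t => ENNReal.ofReal (kernel (ψ x) t) * h t) (volume.prod volume) :=
  (measurable_kernel.comp_aemeasurable
    (hψ.comp_fst.prodMk measurable_snd.aemeasurable)).ennreal_ofReal.mul hh.comp_snd

lemma lintegral_lintegral_kernel_le {ψ : ℝ → ℂ} (hψ : AEMeasurable ψ) {h : ℝ → ℝ≥0∞}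
    (hh : AEMeasurable h) {B : ℝ≥0∞} (hB : ∀ t, ∫⁻ x, ENNReal.ofReal (kernel (ψ x) t) ≤ B) :
    ∫⁻ x, ∫⁻ t, ENNReal.ofReal (kernel (ψ x) t) * h t ≤ B * ∫⁻ t, h t := by
  rw [lintegral_lintegral_swap (aemeasurable_kernel_mul hψ hh), ← lintegral_const_mul'' _ hh]
  refine lintegral_mono fun t => ?_
  rw [lintegral_mul_const'' _ (aemeasurable_kernel_comp hψ t)]
  exact mul_le_mul_left (hB t) _

/-- Composition with `φ` is bounded on the Hardy space if Poisson kernels composed with `φ` have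
bounded integrals. -/
lemma lintegral_comp_le_of_kernel {φ F : ℂ → ℂ} (hd : DifferentiableOn ℂ φ upperHalfPlaneSet)
    (hm : Set.MapsTo φ upperHalfPlaneSet upperHalfPlaneSet)
    (hF : DifferentiableOn ℂ F upperHalfPlaneSet) {q : ℝ} (hq : 1 ≤ q) {B D : ℝ≥0∞} (hD : D ≠ ∞)
    (hFD : ∀ y : ℝ, 0 < y → ∫⁻ x : ℝ, ‖F (x + y * Complex.I)‖ₑ ^ q ≤ D) {y : ℝ} (hy : 0 < y)
    (hB : ∀ t, ∫⁻ x : ℝ, ENNReal.ofReal (kernel (φ (x + y * Complex.I)) t) ≤ B) :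
    ∫⁻ x : ℝ, ‖F (φ (x + y * Complex.I))‖ₑ ^ q ≤ 2 * B * D := by
  have hφm : AEMeasurable fun x : ℝ => φ (x + y * Complex.I) :=
    (hd.continuousOn.comp_continuous (by fun_prop) fun x =>
      add_mul_I_mem (by simpa using hy)).measurable.aemeasurable
  have hFm : ∀ ε : ℝ, 0 < ε → AEMeasurable fun t : ℝ => ‖F (t + ε * Complex.I)‖ₑ ^ q := fun ε hε =>
    ((hF.continuousOn.comp_continuous (by fun_prop) fun x =>
      add_mul_I_mem (by simpa using hε)).measurable.enorm.pow_const q).aemeasurable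
  have hpos : ∀ n : ℕ, (0 : ℝ) < 1 / (n + 1) := fun n => by positivity
  -- Boundary values of `F` are avoided: the Poisson domination starts from the line at height `1 /
  -- (n + 1)`, and Fatou is applied as it descends.
  refine lintegral_le_of_le_liminf (g := fun n x => 2 * ∫⁻ t : ℝ,
    ENNReal.ofReal (kernel (φ (x + y * Complex.I)) t) *
      ‖F (t + (1 / (n + 1) : ℝ) * Complex.I)‖ₑ ^ q) (fun n => ?_)
    (Eventually.of_forall fun n => ?_) (Eventually.of_forall fun x => ?_)
  · exact (aemeasurable_kernel_mul hφm (hFm _ (hpos n))).lintegral_prod_right'.const_mul _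
  · rw [lintegral_const_mul' _ _ (by simp), mul_assoc]
    refine mul_le_mul_right ((lintegral_lintegral_kernel_le hφm (hFm _ (hpos n)) hB).trans ?_) _
    exact mul_le_mul_right (hFD _ (hpos n)) _
  · have hs : 0 < (φ (x + y * Complex.I)).im := hm (add_mul_I_mem (by simpa using hy))
    refine le_liminf_of_le (by isBoundedDefault) ?_
    -- With `ε` at most half the height of `z`, replacing the kernel at `z - iε` by the kernel at
    -- `z` costs the factor `2`.
    filter_upwards [(tendsto_one_div_add_one.mono_right nhdsWithin_le_nhds).eventually_le_const
      (half_pos hs)] with n hn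
    obtain ⟨M, hM⟩ := exists_bound_of_lintegral_le hF hq hD hFD (hpos n)
    have hε := hpos n
    set ε : ℝ := 1 / (n + 1) with hεdef
    set z := φ (x + y * Complex.I) with hz
    set w := z + (-ε : ℝ) * Complex.I with hw
    have hwim : w.im = z.im - ε := by rw [hw, add_mul_I_im]; ring
    have hwz : w + ε * Complex.I = z := by rw [hw]; push_cast; ring
    have hw0 : 0 < w.im := by rw [hwim]; linarith
    have h1 := rpow_enorm_le_lintegral_kernel hF hε hM hq hw0
    rw [hwz] at h1
    refine h1.trans ?_
    rw [← lintegral_const_mul' _ _ (by simp)]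
    refine lintegral_mono fun t => ?_
    simp only
    rw [← mul_assoc, ← ENNReal.ofReal_ofNat, ← ENNReal.ofReal_mul (by norm_num)]
    refine mul_le_mul_left (ENNReal.ofReal_le_ofReal ?_) _
    have h2 := kernel_le_kernel_add hw0 hε.le t
    rw [hwz] at h2
    refine h2.trans (mul_le_mul_of_nonneg_right ?_ (kernel_nonneg hs.le t))
    rw [div_le_iff₀ hw0]
    linarith

/-! ### Test functions; the Hardy space criterion. -/

/-- The square of a normalised reproducing kernel. -/
def testFunction (w z : ℂ) : ℂ := (w.im / (z - starRingEnd ℂ w)) ^ 2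

section testFunction

variable {w z : ℂ}

lemma im_le_norm_sub_conj (hz : 0 ≤ z.im) : w.im ≤ ‖z - starRingEnd ℂ w‖ := by
  refine le_trans ?_ ((le_abs_self _).trans (Complex.abs_im_le_norm _))
  rw [Complex.sub_im, Complex.conj_im]
  linarith

lemma sub_conj_ne_zero (hw : 0 < w.im) (hz : 0 ≤ z.im) : z - starRingEnd ℂ w ≠ 0 :=
  norm_pos_iff.1 (hw.trans_le (im_le_norm_sub_conj hz))

lemma differentiableOn_testFunction (hw : 0 < w.im) :
    DifferentiableOn ℂ (testFunction w) {z | 0 ≤ z.im} := by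
  have h : DifferentiableOn ℂ (fun z : ℂ => w.im / (z - starRingEnd ℂ w)) {z | 0 ≤ z.im} :=
    DifferentiableOn.div (by fun_prop) (by fun_prop) fun z hz => sub_conj_ne_zero hw hz
  exact h.pow 2

lemma continuousAt_testFunction (hw : 0 < w.im) (hz : 0 ≤ z.im) :
    ContinuousAt (testFunction w) z := by
  have h : ContinuousAt (fun z : ℂ => w.im / (z - starRingEnd ℂ w)) z :=
    ContinuousAt.div (by fun_prop) (by fun_prop) (sub_conj_ne_zero hw hz)
  exact h.pow 2

lemma norm_testFunction_le (hw : 0 < w.im) (hz : 0 ≤ z.im) : ‖testFunction w z‖ ≤ 1 := by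
  rw [testFunction, norm_pow, norm_div, Complex.norm_real, Real.norm_of_nonneg hw.le]
  exact pow_le_one₀ (by positivity)
    (div_le_one_of_le₀ (im_le_norm_sub_conj hz) (norm_nonneg _))

lemma norm_testFunction_self (hw : 0 < w.im) : ‖testFunction w w‖ = 1 / 4 := by
  have h : w - starRingEnd ℂ w = (2 * w.im : ℝ) * Complex.I := by
    apply Complex.ext <;> simp; ring
  rw [testFunction, h, norm_pow, norm_div, norm_mul, Complex.norm_I, Complex.norm_real,
    Complex.norm_real, Real.norm_of_nonneg hw.le, Real.norm_of_nonneg (by positivity)]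
  field_simp
  norm_num

lemma norm_testFunction_le_kernel (hw : 0 < w.im) {y : ℝ} (hy : 0 ≤ y) (x : ℝ) :
    ‖testFunction w (x + y * Complex.I)‖ ≤ Real.pi * w.im * kernel w x := by
  rw [testFunction, norm_pow, norm_div, Complex.norm_real, Real.norm_of_nonneg hw.le, div_pow,
    ← Complex.normSq_eq_norm_sq, Complex.normSq_apply, kernel]
  have e : Real.pi * w.im * (1 / Real.pi * (w.im / ((w.re - x) ^ 2 + w.im ^ 2))) =
      w.im ^ 2 / ((w.re - x) ^ 2 + w.im ^ 2) := by field_simp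
  rw [e]
  refine div_le_div_of_nonneg_left (by positivity) (by positivity) ?_
  simp only [Complex.sub_re, Complex.add_re, Complex.ofReal_re, Complex.mul_re, Complex.I_re,
    Complex.ofReal_im, Complex.I_im, Complex.conj_re, Complex.sub_im, Complex.add_im,
    Complex.mul_im, Complex.conj_im]
  nlinarith [mul_nonneg hy hw.le]

/-- Since the modulus is at most `1`, its `q`-th power is at most itself, and hence at most `π * Im
w` times a probability density. -/
lemma lintegral_testFunction_le (hw : 0 < w.im) {q : ℝ} (hq : 1 ≤ q) {y : ℝ} (hy : 0 ≤ y) :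
    ∫⁻ x : ℝ, ‖testFunction w (x + y * Complex.I)‖ₑ ^ q ≤ ENNReal.ofReal (Real.pi * w.im) := by
  have hpi := Real.pi_pos
  calc _ ≤ ∫⁻ x : ℝ, ENNReal.ofReal (Real.pi * w.im) * ENNReal.ofReal (kernel w x) := by
        refine lintegral_mono fun x => ?_
        have h1 : ‖testFunction w (x + y * Complex.I)‖ₑ ≤ 1 := by
          rw [← ofReal_norm, ENNReal.ofReal_le_one]
          exact norm_testFunction_le hw (by simpa using hy)
        refine (ENNReal.rpow_le_rpow_of_exponent_ge h1 hq).trans ?_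
        rw [ENNReal.rpow_one, ← ENNReal.ofReal_mul (by positivity), ← ofReal_norm]
        exact ENNReal.ofReal_le_ofReal (norm_testFunction_le_kernel hw hy x)
    _ = _ := by
        rw [lintegral_const_mul' _ _ ENNReal.ofReal_ne_top, lintegral_kernel hw, mul_one]

end testFunction

/-- The `+ 1` keeps the denominator positive even when `C = 0`. -/
lemma le_mul_of_ofReal_le {q Y s : ℝ} (hq : 1 ≤ q) (hY : 0 < Y) (hs : 0 < s) {C : ℝ≥0}
    (h : ENNReal.ofReal (1 / 4) ^ q ≤
      ENNReal.ofReal (2 / (Real.pi * Y)) * (C ^ q * ENNReal.ofReal (Real.pi * s))) :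
    1 / (2 * C ^ q / (1 / 4) ^ q + 1) * Y ≤ s := by
  have hpi := Real.pi_pos
  have hq0 : 0 ≤ q := by linarith
  have hC : 0 ≤ (C : ℝ) ^ q := by positivity
  have h4 : (0 : ℝ) < (1 / 4) ^ q := by positivity
  rw [← ENNReal.ofReal_coe_nnreal, ENNReal.ofReal_rpow_of_nonneg C.coe_nonneg hq0,
    ENNReal.ofReal_rpow_of_nonneg (by norm_num) hq0, ← ENNReal.ofReal_mul hC,
    ← ENNReal.ofReal_mul (by positivity), ENNReal.ofReal_le_ofReal_iff (by positivity)] at h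
  have e : 2 / (Real.pi * Y) * ((C : ℝ) ^ q * (Real.pi * s)) = 2 * C ^ q * s / Y := by field_simp
  rw [e, le_div_iff₀ hY] at h
  rw [one_div_mul_eq_div, div_le_iff₀ (by positivity)]
  have h' : Y ≤ 2 * C ^ q / (1 / 4) ^ q * s := by
    rw [div_mul_eq_mul_div, le_div_iff₀ h4]
    linarith
  linarith

lemma growth_of_testFunction {φ : ℂ → ℂ} (hm : Set.MapsTo φ upperHalfPlaneSet upperHalfPlaneSet)
    {q : ℝ} (hq : 1 ≤ q) {C : ℝ≥0}
    (h : ∀ Y : ℝ, 0 < Y →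
      ‖testFunction (φ (Y * Complex.I)) (φ (Y * Complex.I))‖ₑ ^ q ≤
        ENNReal.ofReal (2 / (Real.pi * Y)) *
          (C ^ q * ENNReal.ofReal (Real.pi * (φ (Y * Complex.I)).im))) :
    ∃ c : ℝ, 0 < c ∧ ∀ᶠ Y : ℝ in atTop, c * Y ≤ ‖φ (Y * Complex.I)‖ := by
  refine ⟨1 / (2 * C ^ q / (1 / 4) ^ q + 1), by positivity, ?_⟩
  filter_upwards [eventually_gt_atTop 0] with Y hY
  have hs : 0 < (φ (Y * Complex.I)).im := hm (mul_I_mem hY)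
  have h1 := h Y hY
  rw [← ofReal_norm, norm_testFunction_self hs] at h1
  exact (le_mul_of_ofReal_le hq hY hs h1).trans
    ((le_abs_self _).trans (Complex.abs_im_le_norm _))

lemma CompBoundedOnHardy.growth {φ : ℂ → ℂ} (hd : DifferentiableOn ℂ φ upperHalfPlaneSet)
    (hm : Set.MapsTo φ upperHalfPlaneSet upperHalfPlaneSet) {p : ℝ≥0∞} (hp : 1 ≤ p)
    (hp_top : p ≠ ∞) (h : CompBoundedOnHardy φ p) :
    ∃ c : ℝ, 0 < c ∧ ∀ᶠ Y : ℝ in atTop, c * Y ≤ ‖φ (Y * Complex.I)‖ := by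
  obtain ⟨C, hC⟩ := h
  have hq := one_le_toReal hp hp_top
  have hq0 : 0 < p.toReal := by linarith
  refine growth_of_testFunction hm hq (C := C) fun Y hY => ?_
  have hs : 0 < (φ (Y * Complex.I)).im := hm (mul_I_mem hY)
  set w := φ (Y * Complex.I) with hw
  have hnorm : hardyNorm (testFunction w) p ≤ ENNReal.ofReal (Real.pi * w.im) ^ p.toReal⁻¹ := by
    rw [hardyNorm_le_iff hp hp_top]
    intro y hy
    rw [ENNReal.rpow_inv_rpow hq0.ne']
    exact lintegral_testFunction_le hs hq hy.le
  have hdt : DifferentiableOn ℂ (testFunction w) upperHalfPlaneSet :=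
    (differentiableOn_testFunction hs).mono fun z (hz : 0 < z.im) => hz.le
  have hmem : MemHardy (testFunction w) p :=
    ⟨hdt, hnorm.trans_lt (ENNReal.rpow_lt_top_of_nonneg (by positivity) ENNReal.ofReal_ne_top)⟩
  have h1 := (hC _ hmem).2.trans (mul_le_mul_right hnorm _)
  rw [hardyNorm_le_iff hp hp_top] at h1
  have h2 := h1 (Y / 2) (half_pos hY)
  rw [ENNReal.mul_rpow_of_nonneg _ _ hq0.le, ENNReal.rpow_inv_rpow hq0.ne'] at h2
  have him : (((Y / 2 : ℝ) : ℂ) * Complex.I).im = Y / 2 := by simp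
  -- The point `iY` is seen from the line at height `Y / 2`; the kernel is then at most `1 / (π * (Y
  -- / 2))`.
  have h3 := rpow_enorm_le_lintegral_kernel (hdt.comp hd hm) (half_pos hY) (M := 1)
    (fun z hz => norm_testFunction_le hs
      (le_of_lt (hm (show 0 < z.im from (half_pos hY).trans_le hz)))) hq
    (w := ((Y / 2 : ℝ) : ℂ) * Complex.I) (by rw [him]; exact half_pos hY)
  rw [← add_mul, ← Complex.ofReal_add, add_halves, Function.comp_apply, ← hw] at h3
  refine h3.trans ?_
  refine le_trans (lintegral_mono fun t => mul_le_mul_left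
    (ENNReal.ofReal_le_ofReal (kernel_le (by rw [him]; exact half_pos hY) t)) _) ?_
  rw [lintegral_const_mul' _ _ ENNReal.ofReal_ne_top, him,
    show 1 / (Real.pi * (Y / 2)) = 2 / (Real.pi * Y) by field_simp]
  exact mul_le_mul_right h2 _

lemma compBoundedOnHardy_of_growth {φ : ℂ → ℂ} (hd : DifferentiableOn ℂ φ upperHalfPlaneSet)
    (hm : Set.MapsTo φ upperHalfPlaneSet upperHalfPlaneSet) {p : ℝ≥0∞} (hp : 1 ≤ p)
    (hp_top : p ≠ ∞) {c : ℝ} (hc : 0 < c)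
    (hgrowth : ∀ᶠ Y : ℝ in atTop, c * Y ≤ ‖φ (Y * Complex.I)‖) : CompBoundedOnHardy φ p := by
  have hq := one_le_toReal hp hp_top
  obtain ⟨C, hC⟩ := exists_mul_rpow_eq (2 * (2 * (4 / c).toNNReal)) hq
  refine ⟨C, fun F hF => ?_⟩
  have key : hardyNorm (F ∘ φ) p ≤ C * hardyNorm F p := by
    rw [hardyNorm_le_iff hp hp_top]
    intro y hy
    rw [← hC]
    have hline : ∀ x : ℝ, (x : ℂ) + y * Complex.I ∈ upperHalfPlaneSet := fun x =>
      add_mul_I_mem (by simpa using hy)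
    have hψ : AEMeasurable fun x : ℝ => φ (x + y * Complex.I) :=
      (hd.continuousOn.comp_continuous (by fun_prop) hline).measurable.aemeasurable
    have hB := fun t => lintegral_kernel_comp_le_of_add hψ
      (Eventually.of_forall fun x => le_of_lt (hm (hline x)))
      fun δ hδ => lintegral_kernel_comp_le hd hm hc hgrowth hy hδ t
    have := lintegral_comp_le_of_kernel hd hm hF.1 hq
      (ENNReal.rpow_ne_top_of_nonneg (by linarith) hF.2.ne)
      ((hardyNorm_le_iff hp hp_top).1 le_rfl) hy hB
    exact this
  exact ⟨⟨hF.1.comp hd hm, key.trans_lt (ENNReal.mul_lt_top ENNReal.coe_lt_top hF.2)⟩, key⟩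

/-! ### Composition on `L^p` of the line. -/

section

variable {ψ : ℝ → ℂ} {B : ℝ≥0}

/-- Distribution of the values of `ψ` that do not lie in the upper half-plane. -/
def realValueMeasure (ψ : ℝ → ℂ) : Measure ℝ :=
  (volume.restrict {x | 0 < (ψ x).im}ᶜ).map fun x => (ψ x).re

lemma measurableSet_im_pos (hψ : Measurable ψ) : MeasurableSet {x | 0 < (ψ x).im} :=
  measurableSet_lt measurable_const (Complex.measurable_im.comp hψ)

/-- Where `ψ` is real and within `r` of `u`, the kernel at height `r` is at least `1 / (2πr)`. Hence
such points have measure at most `2πrB`, which is `πB` times the length of the ball. -/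
lemma realValueMeasure_closedBall_le (hψ : Measurable ψ) (h0 : ∀ᵐ x, 0 ≤ (ψ x).im)
    (hB : ∀ δ : ℝ, 0 < δ → ∀ t, ∫⁻ x, ENNReal.ofReal (kernel (ψ x + δ * Complex.I) t) ≤ B)
    (u : ℝ) {r : ℝ} (hr : 0 < r) :
    realValueMeasure ψ (Metric.closedBall u r) ≤
      ((Real.pi.toNNReal * B) • (volume : Measure ℝ)) (Metric.closedBall u r) := by
  have hpi := Real.pi_pos
  have hre : Measurable fun x => (ψ x).re := Complex.measurable_re.comp hψ
  set A := (fun x => (ψ x).re) ⁻¹' Metric.closedBall u r ∩ {x | 0 < (ψ x).im}ᶜ with hA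
  have hAm : MeasurableSet A :=
    (hre Metric.isClosed_closedBall.measurableSet).inter (measurableSet_im_pos hψ).compl
  have h1 : ENNReal.ofReal (1 / (2 * Real.pi * r)) * volume A ≤ B := by
    refine le_trans ?_ (hB r hr u)
    rw [← setLIntegral_const, ← lintegral_indicator hAm]
    refine lintegral_mono_ae (h0.mono fun x hx => ?_)
    by_cases hxA : x ∈ A
    · rw [Set.indicator_of_mem hxA]
      refine ENNReal.ofReal_le_ofReal ?_
      have him : (ψ x).im = 0 := le_antisymm (not_lt.1 hxA.2) hx
      have hd : |(ψ x).re - u| ≤ r := hxA.1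
      have hd2 := sq_le_sq' (abs_le.1 hd).1 (abs_le.1 hd).2
      simp only [kernel, add_mul_I_im, him, zero_add, Complex.add_re, Complex.mul_re,
        Complex.ofReal_re, Complex.I_re, mul_zero, Complex.ofReal_im, Complex.I_im, zero_mul,
        sub_zero, add_zero]
      rw [div_mul_div_comm, div_le_div_iff₀ (by positivity) (by positivity)]
      nlinarith [mul_le_mul_of_nonneg_left hd2 hpi.le]
    · rw [Set.indicator_of_notMem hxA]
      exact zero_le
  have e : realValueMeasure ψ (Metric.closedBall u r) = volume A := by
    rw [realValueMeasure, Measure.map_apply hre Metric.isClosed_closedBall.measurableSet,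
      Measure.restrict_apply (hre Metric.isClosed_closedBall.measurableSet)]
  rw [e, Measure.smul_apply, Real.volume_closedBall, ENNReal.smul_def, smul_eq_mul,
    ENNReal.coe_mul]
  calc volume A = ENNReal.ofReal (Real.pi * (2 * r)) *
      (ENNReal.ofReal (1 / (2 * Real.pi * r)) * volume A) := by
        rw [← mul_assoc, ← ENNReal.ofReal_mul (by positivity),
          show Real.pi * (2 * r) * (1 / (2 * Real.pi * r)) = 1 by field_simp,
          ENNReal.ofReal_one, one_mul]
    _ ≤ ENNReal.ofReal (Real.pi * (2 * r)) * B := mul_le_mul_right h1 _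
    _ = _ := by
        rw [ENNReal.ofReal_mul hpi.le]
        change ENNReal.ofReal Real.pi * _ * _ = ENNReal.ofReal Real.pi * _ * _
        ring

/-- Besicovitch's covering theorem extends the comparison from small balls about every point to all
measurable sets. -/
lemma realValueMeasure_le (hψ : Measurable ψ) (h0 : ∀ᵐ x, 0 ≤ (ψ x).im)
    (hB : ∀ δ : ℝ, 0 < δ → ∀ t, ∫⁻ x, ENNReal.ofReal (kernel (ψ x + δ * Complex.I) t) ≤ B) :
    realValueMeasure ψ ≤ (Real.pi.toNNReal * B) • (volume : Measure ℝ) := by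
  have : SFinite (realValueMeasure ψ) := by unfold realValueMeasure; infer_instance
  refine Measure.le_iff.2 fun s _ =>
    (Besicovitch.vitaliFamily (realValueMeasure ψ)).measure_le_of_frequently_le _
      Measure.AbsolutelyContinuous.rfl s fun x _ => ?_
  refine (Besicovitch.tendsto_filterAt (realValueMeasure ψ) x).frequently (Eventually.frequently ?_)
  filter_upwards [self_mem_nhdsWithin] with r hr using realValueMeasure_closedBall_le hψ h0 hB x hr

lemma realValueMeasure_absolutelyContinuous (hψ : Measurable ψ) (h0 : ∀ᵐ x, 0 ≤ (ψ x).im)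
    (hB : ∀ δ : ℝ, 0 < δ → ∀ t, ∫⁻ x, ENNReal.ofReal (kernel (ψ x + δ * Complex.I) t) ≤ B) :
    realValueMeasure ψ ≪ volume :=
  (Measure.absolutelyContinuous_of_le (realValueMeasure_le hψ h0 hB)).trans (Measure.smul_absolutelyContinuous)

lemma measurable_poissonIntegral {f : ℝ → ℂ} (hf : Measurable f) :
    StronglyMeasurable (poissonIntegral f) := by
  have : Measurable fun z : ℂ × ℝ => (kernel z.1 z.2 : ℂ) * f z.2 :=
    (Complex.measurable_ofReal.comp measurable_kernel).mul (hf.comp measurable_snd)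
  exact this.stronglyMeasurable.integral_prod_right'

/-- Where `ψ` is real, absolute continuity is what makes `f ∘ ψ` insensitive to changes of `f` on
null sets; the Poisson integral is so automatically. -/
lemma aestronglyMeasurable_extend (hψ : Measurable ψ) (hac : realValueMeasure ψ ≪ volume) {f : ℝ → ℂ}
    (hf : AEStronglyMeasurable f volume) :
    AEStronglyMeasurable (fun x => extend f (ψ x)) volume := by
  classical
  have hre : Measurable fun x => (ψ x).re := Complex.measurable_re.comp hψ
  have h1 : AEStronglyMeasurable (fun x => poissonIntegral f (ψ x)) volume := by
    have : (fun x => poissonIntegral f (ψ x)) = fun x => poissonIntegral (hf.mk f) (ψ x) :=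
      funext fun x => poissonIntegral_congr hf.ae_eq_mk _
    rw [this]
    exact ((measurable_poissonIntegral hf.stronglyMeasurable_mk.measurable).comp_measurable
      hψ).aestronglyMeasurable
  exact AEStronglyMeasurable.piecewise (s := {x | 0 < (ψ x).im}) (measurableSet_im_pos hψ)
    h1.restrict ((hf.mono_ac hac).comp_measurable hre)

/-- The constant `2B` comes from the points mapped into the half-plane, by Jensen and Tonelli; `πB`
comes from the points mapped to the line. -/
lemma lintegral_extend_le (hψ : Measurable ψ) (h0 : ∀ᵐ x, 0 ≤ (ψ x).im)
    (hB : ∀ δ : ℝ, 0 < δ → ∀ t, ∫⁻ x, ENNReal.ofReal (kernel (ψ x + δ * Complex.I) t) ≤ B)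
    {f : ℝ → ℂ} (hf : AEStronglyMeasurable f volume) {q : ℝ} (hq : 1 ≤ q) :
    ∫⁻ x, ‖extend f (ψ x)‖ₑ ^ q ≤
      (2 * B + Real.pi.toNNReal * B : ℝ≥0) * ∫⁻ x, ‖f x‖ₑ ^ q := by
  have hS := measurableSet_im_pos hψ
  have hac := realValueMeasure_absolutelyContinuous hψ h0 hB
  have hfq : AEMeasurable (fun x => ‖f x‖ₑ ^ q) := hf.enorm.pow_const q
  rw [← lintegral_add_compl _ hS, ENNReal.coe_add, add_mul]
  refine add_le_add ?_ ?_
  · calc _ ≤ ∫⁻ x in {x | 0 < (ψ x).im}, ∫⁻ t, ENNReal.ofReal (kernel (ψ x) t) * ‖f t‖ₑ ^ q := by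
          refine setLIntegral_mono' hS fun x (hx : 0 < (ψ x).im) => ?_
          rw [extend, if_pos hx]
          exact rpow_enorm_poissonIntegral_le hx hf hq
      _ ≤ ∫⁻ x, ∫⁻ t, ENNReal.ofReal (kernel (ψ x) t) * ‖f t‖ₑ ^ q := setLIntegral_le_lintegral _ _
      _ ≤ _ := lintegral_lintegral_kernel_le hψ.aemeasurable hfq fun t => by
          rw [ENNReal.coe_mul]
          exact lintegral_kernel_comp_le_of_add hψ.aemeasurable h0 fun δ hδ => hB δ hδ t
  · calc _ = ∫⁻ x in {x | 0 < (ψ x).im}ᶜ, ‖f (ψ x).re‖ₑ ^ q := by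
          refine setLIntegral_congr_fun hS.compl fun x (hx : ¬ 0 < (ψ x).im) => ?_
          simp only [extend, if_neg hx]
      _ = ∫⁻ u, ‖f u‖ₑ ^ q ∂realValueMeasure ψ :=
          (lintegral_map' (hfq.mono_ac hac) (Complex.measurable_re.comp hψ).aemeasurable).symm
      _ ≤ ∫⁻ u, ‖f u‖ₑ ^ q ∂((Real.pi.toNNReal * B) • (volume : Measure ℝ)) :=
          lintegral_mono' (realValueMeasure_le hψ h0 hB) le_rfl
      _ = _ := by rw [lintegral_smul_measure]; rfl

lemma compBoundedOnLp_of_growth {φ : ℂ → ℂ} (hd : DifferentiableOn ℂ φ upperHalfPlaneSet)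
    (hm : Set.MapsTo φ upperHalfPlaneSet upperHalfPlaneSet) (hψ : Measurable ψ)
    (h0 : ∀ᵐ x, 0 ≤ (ψ x).im)
    (hlim : ∀ᵐ x : ℝ, Tendsto φ (𝓝[upperHalfPlaneSet] (x : ℂ)) (𝓝 (ψ x))) {p : ℝ≥0∞} (hp : 1 ≤ p)
    (hp_top : p ≠ ∞) {c : ℝ} (hc : 0 < c)
    (hgrowth : ∀ᶠ Y : ℝ in atTop, c * Y ≤ ‖φ (Y * Complex.I)‖) : CompBoundedOnLp φ p := by
  have hq := one_le_toReal hp hp_top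
  have hB : ∀ δ : ℝ, 0 < δ → ∀ t, ∫⁻ x, ENNReal.ofReal (kernel (ψ x + δ * Complex.I) t) ≤
      (4 / c).toNNReal := fun δ hδ t =>
    lintegral_kernel_boundary_le hd.continuousOn h0 (hlim.mono fun x hx => tendsto_vertical hx) hδ
      fun y hy => lintegral_kernel_comp_le hd hm hc hgrowth hy hδ t
  obtain ⟨C, hC⟩ := exists_mul_rpow_eq (2 * (4 / c).toNNReal + Real.pi.toNNReal * (4 / c).toNNReal) hq
  refine ⟨C, fun f hf => ?_⟩
  have hae : compLine φ f =ᵐ[volume] fun x => extend f (ψ x) :=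
    hlim.mono fun x hx => by rw [compLine, boundaryValue_eq hx]
  have key : eLpNorm (compLine φ f) p volume ≤ C * eLpNorm f p volume := by
    rw [eLpNorm_congr_ae hae, eLpNorm_le_iff_lintegral hp hp_top, ← hC]
    exact (lintegral_extend_le hψ h0 hB hf.1 hq).trans
      (mul_le_mul_right ((eLpNorm_le_iff_lintegral hp hp_top).1 le_rfl) _)
  refine ⟨⟨(aestronglyMeasurable_extend hψ (realValueMeasure_absolutelyContinuous hψ h0 hB)
    hf.1).congr hae.symm, ?_⟩, key⟩
  exact key.trans_lt (ENNReal.mul_lt_top ENNReal.coe_lt_top hf.2)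

/-- The Poisson formula for bounded holomorphic functions in terms of their boundary values. -/
lemma poissonIntegral_boundary_eq {G : ℂ → ℂ} (hG : DifferentiableOn ℂ G upperHalfPlaneSet) {M : ℝ}
    (hM : ∀ z ∈ upperHalfPlaneSet, ‖G z‖ ≤ M) {g : ℝ → ℂ}
    (hg : ∀ᵐ x : ℝ, Tendsto (fun y : ℝ => G (x + y * Complex.I)) (𝓝[>] 0) (𝓝 (g x))) {w : ℂ}
    (hw : 0 < w.im) : poissonIntegral g w = G w := by
  have hpos : ∀ n : ℕ, (0 : ℝ) < 1 / (n + 1) := fun n => by positivity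
  have h1 : ∀ n : ℕ, poissonIntegral (fun t : ℝ => G (t + (1 / (n + 1) : ℝ) * Complex.I)) w =
      G (w + (1 / (n + 1) : ℝ) * Complex.I) := by
    intro n
    have hmaps : Set.MapsTo (fun z : ℂ => z + (1 / (n + 1) : ℝ) * Complex.I) {z | 0 ≤ z.im}
        upperHalfPlaneSet := fun z (hz : 0 ≤ z.im) => add_mul_I_mem (by have := hpos n; linarith)
    have hd : DifferentiableOn ℂ (fun z => G (z + (1 / (n + 1) : ℝ) * Complex.I))
        {z | 0 ≤ z.im} := hG.comp (by fun_prop) hmaps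
    exact poissonIntegral_ofReal_eq hd.continuousOn (hd.mono fun z (hz : 0 < z.im) => hz.le)
      (fun z hz => hM _ (hmaps hz)) hw
  have h2 : Tendsto (fun n : ℕ => G (w + (1 / (n + 1) : ℝ) * Complex.I)) atTop (𝓝 (G w)) := by
    have hc : ContinuousAt G w :=
      (hG.differentiableAt (isOpen_upperHalfPlaneSet.mem_nhds hw)).continuousAt
    refine hc.tendsto.comp ?_
    have h3 : Tendsto (fun y : ℝ => w + y * Complex.I) (𝓝 0) (𝓝 w) :=
      Continuous.tendsto' (by fun_prop) _ _ (by simp)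
    exact h3.comp (tendsto_one_div_add_one.mono_right nhdsWithin_le_nhds)
  refine tendsto_nhds_unique ?_ h2
  simp_rw [← h1, poissonIntegral_eq]
  have i0 : Integrable fun t : ℝ => kernel w t * M := (integrable_kernel hw).mul_const M
  refine tendsto_integral_of_dominated_convergence (fun t : ℝ => kernel w t * M) (fun n => ?_) i0
    (fun n => Eventually.of_forall fun t => ?_) (hg.mono fun t ht => ?_)
  · refine (Complex.measurable_ofReal.comp (measurable_kernel_right w)).aestronglyMeasurable.mul ?_
    exact (hG.continuousOn.comp_continuous (by fun_prop) fun t =>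
      add_mul_I_mem (by simpa using (hpos n))).aestronglyMeasurable
  · rw [norm_mul, Complex.norm_real, Real.norm_of_nonneg (kernel_nonneg hw.le t)]
    exact mul_le_mul_of_nonneg_left
      (hM _ (add_mul_I_mem (by simpa using (hpos n)))) (kernel_nonneg hw.le t)
  · exact (ht.comp tendsto_one_div_add_one).const_mul _

/-- Holomorphy matters here: the harmonic extension of the boundary function is the test function
itself, so composition on the line agrees with composition in the half-plane. -/
lemma extend_testFunction {w z : ℂ} (hw : 0 < w.im) (hz : 0 ≤ z.im) :
    extend (fun t => testFunction w t) z = testFunction w z := by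
  have hd := differentiableOn_testFunction hw
  rw [extend]
  split_ifs with h
  · exact poissonIntegral_ofReal_eq hd.continuousOn (hd.mono fun z (hz : 0 < z.im) => hz.le)
      (fun z hz => norm_testFunction_le hw hz) h
  · congr 1
    apply Complex.ext
    · simp
    · simpa using le_antisymm hz (not_lt.1 h)

lemma CompBoundedOnLp.growth {φ : ℂ → ℂ} (hd : DifferentiableOn ℂ φ upperHalfPlaneSet)
    (hm : Set.MapsTo φ upperHalfPlaneSet upperHalfPlaneSet) (h0 : ∀ᵐ x, 0 ≤ (ψ x).im)
    (hlim : ∀ᵐ x : ℝ, Tendsto φ (𝓝[upperHalfPlaneSet] (x : ℂ)) (𝓝 (ψ x))) {p : ℝ≥0∞} (hp : 1 ≤ p)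
    (hp_top : p ≠ ∞) (h : CompBoundedOnLp φ p) :
    ∃ c : ℝ, 0 < c ∧ ∀ᶠ Y : ℝ in atTop, c * Y ≤ ‖φ (Y * Complex.I)‖ := by
  obtain ⟨C, hC⟩ := h
  have hq := one_le_toReal hp hp_top
  have hq0 : 0 < p.toReal := by linarith
  refine growth_of_testFunction hm hq (C := C) fun Y hY => ?_
  have hpi := Real.pi_pos
  have hs : 0 < (φ (Y * Complex.I)).im := hm (mul_I_mem hY)
  set w := φ (Y * Complex.I) with hw
  have hdt := differentiableOn_testFunction hs
  have hnorm : eLpNorm (fun t : ℝ => testFunction w t) p volume ≤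
      ENNReal.ofReal (Real.pi * w.im) ^ p.toReal⁻¹ := by
    rw [eLpNorm_le_iff_lintegral hp hp_top, ENNReal.rpow_inv_rpow hq0.ne']
    simpa using lintegral_testFunction_le hs hq (le_refl (0 : ℝ))
  have hmem : MemLp (fun t : ℝ => testFunction w t) p volume :=
    ⟨(hdt.continuousOn.comp_continuous Complex.continuous_ofReal
      fun t => by simp).aestronglyMeasurable,
      hnorm.trans_lt (ENNReal.rpow_lt_top_of_nonneg (by positivity) ENNReal.ofReal_ne_top)⟩
  have hae : compLine φ (fun t : ℝ => testFunction w t) =ᵐ[volume]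
      fun x => testFunction w (ψ x) := by
    filter_upwards [hlim, h0] with x h1 h2
    rw [compLine, boundaryValue_eq h1, extend_testFunction hs h2]
  have h1 := (hC _ hmem).2.trans (mul_le_mul_right hnorm _)
  rw [eLpNorm_congr_ae hae, eLpNorm_le_iff_lintegral hp hp_top,
    ENNReal.mul_rpow_of_nonneg _ _ hq0.le, ENNReal.rpow_inv_rpow hq0.ne'] at h1
  have hmeas : AEStronglyMeasurable (fun x => testFunction w (ψ x)) volume :=
    ((hC _ hmem).1.1.congr hae)
  have h2 := poissonIntegral_boundary_eq (G := testFunction w ∘ φ) (M := 1)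
    ((hdt.mono fun z (hz : 0 < z.im) => hz.le).comp hd hm)
    (fun z hz => norm_testFunction_le hs (le_of_lt (hm hz))) (g := fun x => testFunction w (ψ x))
    (by
      filter_upwards [hlim, h0] with x h3 h4
      exact (continuousAt_testFunction hs h4).tendsto.comp (tendsto_vertical h3)) (mul_I_mem hY)
  have him : ((Y : ℂ) * Complex.I).im = Y := by simp
  rw [Function.comp_apply, ← hw] at h2
  rw [← h2]
  refine (rpow_enorm_poissonIntegral_le (mul_I_mem hY) hmeas hq).trans ?_
  -- Evaluation from the real line costs only `1 / (π * Y)`; it is weakened to the constant shared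
  -- with the Hardy case.
  refine le_trans (lintegral_mono fun t => mul_le_mul_left
    (ENNReal.ofReal_le_ofReal ((kernel_le (mul_I_mem hY) t).trans
      (?_ : _ ≤ 2 / (Real.pi * Y)))) _) ?_
  · rw [him]
    gcongr
    norm_num
  · rw [lintegral_const_mul' _ _ ENNReal.ofReal_ne_top]
    exact mul_le_mul_right h1 _

end

end HalfPlane

end

theorem mainTheorem7 {m n : ℕ} (lam : Fin (m + 1) → ℂ) (a : Fin (m + 1) → ℝ)
    (mu : Fin (n + 1) → ℂ) (b : Fin (n + 1) → ℝ) (φ : ℂ → ℂ)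
    (hφ : HalfPlane.IsQLP lam a mu b φ) (p : ℝ≥0∞) (hp : 1 ≤ p) (hp_top : p ≠ ∞) :
    (HalfPlane.CompBoundedOnLp φ p ↔ 1 ≤ a 0 - b 0) ∧
      (HalfPlane.CompBoundedOnHardy φ p ↔ 1 ≤ a 0 - b 0) := by
  have hd := hφ.differentiableOn
  have hm := hφ.mapsTo
  have hlim := hφ.ae_tendsto
  have hψ : Measurable fun x : ℝ => HalfPlane.powerSum lam a x / HalfPlane.powerSum mu b x :=
    ((HalfPlane.measurable_powerSum lam a).comp Complex.measurable_ofReal).div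
      ((HalfPlane.measurable_powerSum mu b).comp Complex.measurable_ofReal)
  have h0 : ∀ᵐ x : ℝ, 0 ≤ (HalfPlane.powerSum lam a x / HalfPlane.powerSum mu b x).im := by
    filter_upwards [hlim] with x hx
    refine ge_of_tendsto (Complex.continuous_im.continuousAt.tendsto.comp
      (HalfPlane.tendsto_vertical hx)) ?_
    filter_upwards [self_mem_nhdsWithin] with y (hy : 0 < y)
    exact le_of_lt (hm (HalfPlane.add_mul_I_mem (by simpa using hy)))
  -- From here the exponents play no role: both equivalences concern growth on the imaginary axis.
  rw [← hφ.exists_growth_iff]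
  refine ⟨⟨fun h => h.growth hd hm h0 hlim hp hp_top, ?_⟩,
    ⟨fun h => h.growth hd hm hp hp_top, ?_⟩⟩
  · rintro ⟨c, hc, h⟩
    exact HalfPlane.compBoundedOnLp_of_growth hd hm hψ h0 hlim hp hp_top hc h
  · rintro ⟨c, hc, h⟩
    exact HalfPlane.compBoundedOnHardy_of_growth hd hm hp hp_top hc h
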